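/- A graph $G$ is $K_4$-saturated if it contains no $K_4$ and adding any missing edge to $G$ creates a $K_4$. For graphs $H$ and $F$, let $\mathrm{sat}_t(n,H,F)$ be the minimum number of copies of $H$ in an $n$-vertex $F$-saturated graph with minimum degree $t$. For $n \ge 9$, let $H_4(n)$ be the following graph on $n$ vertices. Its vertex set is $A \cup B \cup X$ (disjoint), where $A=\{a_1,a_2,a_3,a_4\}$, $B=\{b_{123},b_{124},b_{134},b_{234}\}$ and $|X|=n-8$. The edges inside $A$ are $a_1a_2$ and $a_3a_4$; the edges inside $B$ are $b_{123}b_{234}$, $b_{234}b_{124}$, $b_{124}b_{134}$, $b_{134}b_{123}$; $a_r$ is adjacent to $b_{ijk}$ if and only if $r\in\{i,j,k\}$; $X$ is an independent set, and each vertex of $X$ is adjacent to all of $A$ and to no vertex of $B$. Theorem. Let $n \ge 14$ and let $G$ be an $n$-vertex $K_4$-saturated graph with minimum degree exactly $4$. Then $G$ contains at least $2n-4$ triangles, and $G$ contains exactly $2n-4$ triangles if $G$ is isomorphic to $H_4(n)$. If moreover $n \ge 15$ and $G$ contains exactly $2n-4$ triangles, then $G$ is isomorphic to $H_4(n)$.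 Furthermore, $\mathrm{sat}_4(n,K_3,K_4)=2n-4$ for every $n \ge 14$; for $n \ge 15$, $H_4(n)$ is, up to isomorphism, the unique extremal graph. -/

import Mathlib

/-- `G` is `F`-saturated: it is `F`-free, and adding any missing edge creates a copy of `F`. -/
def IsGraphSaturated {V W : Type*} (F : SimpleGraph W) (G : SimpleGraph V) : Prop :=
  F.Free G ∧ ∀ u v : V, u ≠ v → ¬ G.Adj u v → F.IsContained (G ⊔ SimpleGraph.edge u v)

open Classical in
/-- `sat_t(n, H, F)`: the minimum number of copies of `H` in an `n`-vertex `F`-saturated graph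
with minimum degree `t`. (It is `0` by convention if there is no such graph.) -/
noncomputable def satMinDeg {W₁ W₂ : Type*} (t n : ℕ) (H : SimpleGraph W₁) (F : SimpleGraph W₂) :
    ℕ :=
  sInf {m : ℕ | ∃ G : SimpleGraph (Fin n),
    IsGraphSaturated F G ∧ G.minDegree = t ∧ G.copyCount H = m}

/-- The four vertices `a₁, a₂, a₃, a₄` (numbered `0, 1, 2, 3` here) span exactly the two edges
`a₁a₂` and `a₃a₄`. -/
def graphA : SimpleGraph (Fin 4) :=
  SimpleGraph.fromEdgeSet {s(0, 1), s(2, 3)}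

/-- The four vertices `b_S`, one for each `3`-element subset `S` of the four indices. The vertex
numbered `i` is `b_S` with `S` the complement of `{i}`. They span the `4`-cycle
`b₁₂₃ b₂₃₄ b₁₂₄ b₁₃₄ b₁₂₃`. -/
def graphB : SimpleGraph (Fin 4) :=
  SimpleGraph.fromEdgeSet {s(3, 0), s(0, 2), s(2, 1), s(1, 3)}

/-- The vertices of `H_t(n)`: the sets `A` and `B` of four vertices each, and the sets `X`
and `Y` of `n - t - 4` and `t - 4` vertices. -/
inductive HVertex (t n : ℕ) : Type
  | a (i : Fin 4)
  | b (i : Fin 4)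
  | x (i : Fin (n - t - 4))
  | y (i : Fin (t - 4))

/-- Adjacency in `H_t(n)`: the graphs on `A` and `B` are as above, `a_r` is adjacent to `b_S` if
and only if `r ∈ S`, the sets `X` and `Y` are independent, every vertex of `X` is adjacent to all of
`A ∪ Y` and every vertex of `Y` is adjacent to all of `B ∪ X`. -/
def HAdj (t n : ℕ) : HVertex t n → HVertex t n → Prop
  | .a i, .a j => graphA.Adj i j
  | .b i, .b j => graphB.Adj i j
  | .a r, .b i => r ≠ i
  | .b i, .a r => r ≠ i
  | .x _, .a _ => True
  | .a _, .x _ => True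
  | .x _, .y _ => True
  | .y _, .x _ => True
  | .y _, .b _ => True
  | .b _, .y _ => True
  | _, _ => False

/-- The graph `H_t(n)` (for `t ≥ 4` and `n > 2t`). For `t = 4` the set `Y` is empty. -/
def graphH (t n : ℕ) : SimpleGraph (HVertex t n) where
  Adj := HAdj t n
  symm := by
    constructor
    intro u v h
    cases u <;> cases v <;> simp_all [HAdj, SimpleGraph.adj_comm]
  loopless := by
    constructor
    intro u h
    cases u <;> simp_all [HAdj]

/-! Take a vertex of degree 4, the apex; its four neighbours form the link, and `H` is the graph
induced on it. As there is no K₄, `H` is triangle-free. Every vertex outside the link, the apex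
included, has a type: the set of its neighbours in the link. Saturation against the apex makes every
type contain an edge of `H`, and K₄-freeness forbids two adjacent outer vertices to share both ends
of an edge of `H`. Applied to pairs of non-adjacent link vertices, these facts leave four
possibilities for `H`: two disjoint edges, a path, a 4-cycle or a star (`exists_linkConfig`).

For each `H` there are few types, and saturation becomes a finite condition on them: some pairs of
classes are completely joined (`adj_of_cls`), and some vertices must have a neighbour in a
prescribed class (`exists_nbr`). No triangle lies in the link. A vertex of type `S` forms as many
triangles with two link vertices as `S` contains edges, and an outer edge between types `S` and `S'`
forms |S ∩ S'| triangles with one link vertex (`sum_le_card_triangles`). What remains is arithmetic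
in the class sizes.

For two disjoint edges, let p be the number of vertices whose type is {0,1} plus one more index, and
q the number for {2,3}. Then p, q ≥ 2 and the excess over 2n - 4 is at least 2pq - p - q - 4, which
vanishes only for p = q = 2; all adjacencies are then forced and the graph is H₄(n). The path and
the cycle give strict inequality. For the star all outer vertices see the centre, so they span no
triangle and outer edges have to be found by other means: the minimum degree, and an edge estimate
for triangle-free tripartite graphs with a saturation property (`Tripartite.le_or_le`). Here
strictness is obtained only from n = 15 on. Finally, H₄(n) has at most 2(n - 8) + 12 triangles. -/

open Finset

/-! ### Saturation and triangle counts in elementary terms. -/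

section Basic

variable {V : Type*}

theorem cliqueFree_four_iff {G : SimpleGraph V} :
    G.CliqueFree 4 ↔ ∀ x y z w, G.Adj x y → G.Adj x z → G.Adj x w → G.Adj y z → G.Adj y w →
      G.Adj z w → False := by
  classical
  constructor
  · intro h x y z w h1 h2 h3 h4 h5 h6
    refine h {x, y, z, w} ?_
    rw [SimpleGraph.isNClique_iff]
    refine ⟨?_, ?_⟩
    · simp [SimpleGraph.isClique_iff, Set.pairwise_insert, h1, h2, h3, h4, h5, h6, h1.symm,
        h2.symm, h3.symm, h4.symm, h5.symm, h6.symm]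
    · simp [h1.ne, h2.ne, h3.ne, h4.ne, h5.ne, h6.ne]
  · intro h s hs
    obtain ⟨hc, hcard⟩ := hs
    obtain ⟨x, y, z, w, h1, h2, h3, h4, h5, h6, rfl⟩ := Finset.card_eq_four.1 hcard
    have m : ∀ {p q : V}, p ∈ ({x, y, z, w} : Finset V) → q ∈ ({x, y, z, w} : Finset V) → p ≠ q →
        G.Adj p q := fun hp hq hpq => hc (by exact_mod_cast hp) (by exact_mod_cast hq) hpq
    exact h x y z w (m (by simp) (by simp) h1) (m (by simp) (by simp) h2)
      (m (by simp) (by simp) h3) (m (by simp) (by simp) h4) (m (by simp) (by simp) h5)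
      (m (by simp) (by simp) h6)

/-- A graph is `K₄`-saturated if it is `K₄`-free and any two distinct non-adjacent vertices have two
adjacent common neighbours. -/
theorem isGraphSaturated_four_iff {G : SimpleGraph V} :
    IsGraphSaturated (SimpleGraph.completeGraph (Fin 4)) G ↔ G.CliqueFree 4 ∧
      ∀ x y, x ≠ y → ¬ G.Adj x y →
        ∃ p q, G.Adj p q ∧ G.Adj x p ∧ G.Adj x q ∧ G.Adj y p ∧ G.Adj y q := by
  classical
  have hfree : (SimpleGraph.completeGraph (Fin 4)).Free G ↔ G.CliqueFree 4 := by
    rw [SimpleGraph.Free, ← SimpleGraph.not_cliqueFree_iff_top_isContained, not_not]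
  unfold IsGraphSaturated
  rw [hfree]
  refine and_congr_right fun hG => forall_congr' fun x => forall_congr' fun y =>
    forall_congr' fun hxy => forall_congr' fun hadj => ?_
  rw [← SimpleGraph.not_cliqueFree_iff_top_isContained]
  constructor
  · intro h
    rw [SimpleGraph.CliqueFree] at h
    push Not at h
    obtain ⟨s, hs⟩ := h
    have hx : x ∈ s := hG.mem_of_sup_edge_isNClique hs
    have hs' : (G ⊔ SimpleGraph.edge y x).IsNClique 4 s := by
      rwa [SimpleGraph.edge_comm]
    have hy : y ∈ s := hG.mem_of_sup_edge_isNClique hs'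
    have hcard : ((s.erase x).erase y).card = 2 := by
      rw [card_erase_of_mem (by simp [hxy.symm, hy]), card_erase_of_mem hx, hs.card_eq]
    obtain ⟨p, q, hpq, hs2⟩ := Finset.card_eq_two.1 hcard
    have hp : p ∈ (s.erase x).erase y := by simp [hs2]
    have hq : q ∈ (s.erase x).erase y := by simp [hs2]
    simp only [mem_erase] at hp hq
    have key : ∀ {u v : V}, u ∈ s → v ∈ s → u ≠ v → v ≠ x → v ≠ y → G.Adj u v := by
      intro u v hu hv huv h1 h2
      have := hs.isClique (by exact_mod_cast hu) (by exact_mod_cast hv) huv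
      rw [SimpleGraph.sup_adj, SimpleGraph.edge_adj] at this
      rcases this with h | h
      · exact h
      · rcases h.1 with h | h
        · exact absurd h.2 h2
        · exact absurd h.2 h1
    exact ⟨p, q, key hp.2.2 hq.2.2 hpq hq.2.1 hq.1, key hx hp.2.2 (Ne.symm hp.2.1) hp.2.1 hp.1,
      key hx hq.2.2 (Ne.symm hq.2.1) hq.2.1 hq.1, key hy hp.2.2 (Ne.symm hp.1) hp.2.1 hp.1,
      key hy hq.2.2 (Ne.symm hq.1) hq.2.1 hq.1⟩
  · rintro ⟨p, q, h1, h2, h3, h4, h5⟩ hfree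
    have hle : G ≤ G ⊔ SimpleGraph.edge x y := le_sup_left
    refine cliqueFree_four_iff.1 hfree x y p q ?_ (hle h2) (hle h3) (hle h4) (hle h5) (hle h1)
    rw [SimpleGraph.sup_adj, SimpleGraph.edge_adj]
    exact Or.inr ⟨Or.inl ⟨rfl, rfl⟩, hxy⟩

open Classical in
/-- The vertex sets of the triangles of `G`. -/
noncomputable def triangles [Fintype V] (G : SimpleGraph V) : Finset (Finset V) :=
  univ.filter fun s => G.IsNClique 3 s

theorem mem_triangles [Fintype V] {G : SimpleGraph V} {s : Finset V} :
    s ∈ triangles G ↔ G.IsNClique 3 s := by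
  simp [triangles]

/-- A subgraph isomorphic to a complete graph is determined by its vertex set, so sending a copy to
its vertices is a bijection onto the 3-cliques. -/
theorem copyCount_three_eq [Fintype V] (G : SimpleGraph V) :
    G.copyCount (SimpleGraph.completeGraph (Fin 3)) = (triangles G).card := by
  classical
  have hadj : ∀ G' : G.Subgraph, Nonempty (SimpleGraph.completeGraph (Fin 3) ≃g G'.coe) →
      ∀ x y, G'.Adj x y ↔ x ∈ G'.verts ∧ y ∈ G'.verts ∧ x ≠ y := by
    rintro G' ⟨f⟩ x y
    constructor
    · intro h
      exact ⟨h.fst_mem, h.snd_mem, h.ne⟩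
    · rintro ⟨hx, hy, hxy⟩
      have : G'.coe.Adj ⟨x, hx⟩ ⟨y, hy⟩ := by
        rw [← f.symm.map_rel_iff]
        simp only [SimpleGraph.completeGraph, SimpleGraph.top_adj]
        intro h
        exact hxy (congrArg Subtype.val (f.symm.injective h))
      exact this
  unfold SimpleGraph.copyCount
  refine Finset.card_bij (fun G' _ => G'.verts.toFinset) ?_ ?_ ?_
  · intro G' hG'
    have hG : Nonempty (SimpleGraph.completeGraph (Fin 3) ≃g G'.coe) := by simpa using hG'
    rw [mem_triangles, SimpleGraph.isNClique_iff]
    refine ⟨?_, ?_⟩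
    · intro x hx y hy hxy
      exact ((hadj G' hG x y).2 ⟨by simpa using hx, by simpa using hy, hxy⟩).adj_sub
    · obtain ⟨f⟩ := hG
      rw [Set.toFinset_card, ← Fintype.card_congr f.toEquiv, Fintype.card_fin]
  · intro G₁ h₁ G₂ h₂ h
    have h₁' : Nonempty (SimpleGraph.completeGraph (Fin 3) ≃g G₁.coe) := by simpa using h₁
    have h₂' : Nonempty (SimpleGraph.completeGraph (Fin 3) ≃g G₂.coe) := by simpa using h₂
    have hv : G₁.verts = G₂.verts := by simpa using h
    refine SimpleGraph.Subgraph.ext hv ?_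
    funext x y
    rw [hadj G₁ h₁', hadj G₂ h₂', hv]
  · intro s hs
    rw [mem_triangles] at hs
    refine ⟨(⊤ : G.Subgraph).induce (s : Set V), ?_, by simp⟩
    simp only [mem_filter, mem_univ, true_and]
    have e : Fin 3 ≃ ((s : Set V) : Type _) :=
      (Fintype.equivFinOfCardEq (by simp [hs.card_eq])).symm
    refine ⟨⟨e, ?_⟩⟩
    intro i j
    simp only [SimpleGraph.completeGraph, SimpleGraph.top_adj, SimpleGraph.Subgraph.coe_adj,
      SimpleGraph.Subgraph.induce_adj, SimpleGraph.Subgraph.top_adj]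
    constructor
    · rintro ⟨_, _, h⟩ rfl
      exact h.ne rfl
    · intro h
      have h' : ((e i : V)) ≠ (e j : V) := fun hh => h (e.injective (Subtype.ext hh))
      exact ⟨(e i).2, (e j).2, hs.isClique (e i).2 (e j).2 h'⟩

end Basic

/-! ### Decidable conditions on types. -/

/-- The set `S` of indices contains both ends of an edge of `H`. -/
def SpansEdge (H : Fin 4 → Fin 4 → Bool) (S : Finset (Fin 4)) : Prop :=
  ∃ i ∈ S, ∃ j ∈ S, H i j = true

instance (H : Fin 4 → Fin 4 → Bool) (S : Finset (Fin 4)) : Decidable (SpansEdge H S) := by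
  unfold SpansEdge; infer_instance

/-- The edges of `H` inside `S`, as increasing pairs. -/
def edgePairs (H : Fin 4 → Fin 4 → Bool) (S : Finset (Fin 4)) : Finset (Fin 4 × Fin 4) :=
  univ.filter fun p => p.1 < p.2 ∧ H p.1 p.2 = true ∧ p.1 ∈ S ∧ p.2 ∈ S

/-- Two vertices with types `S` and `S'` may be adjacent. -/
def Compat (H : Fin 4 → Fin 4 → Bool) (S S' : Finset (Fin 4)) : Prop := ¬ SpansEdge H (S ∩ S')

instance (H : Fin 4 → Fin 4 → Bool) (S S' : Finset (Fin 4)) : Decidable (Compat H S S') := by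
  unfold Compat; infer_instance

/-- Two vertices with types `S` and `S'` may be non-adjacent, given that all types that occur
belong to `L`. -/
def MayBeNonadj (H : Fin 4 → Fin 4 → Bool) (L : Finset (Finset (Fin 4)))
    (S S' : Finset (Fin 4)) : Prop :=
  SpansEdge H (S ∩ S') ∨
  (∃ Z ∈ L, Compat H Z S ∧ Compat H Z S' ∧ (S ∩ S' ∩ Z).Nonempty) ∨
  (∃ Z ∈ L, Compat H Z S ∧ Compat H Z S' ∧
    ∃ Z' ∈ L, Compat H Z' S ∧ Compat H Z' S' ∧ Compat H Z Z')

instance (H : Fin 4 → Fin 4 → Bool) (L : Finset (Finset (Fin 4))) (S S' : Finset (Fin 4)) :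
    Decidable (MayBeNonadj H L S S') := by
  unfold MayBeNonadj; infer_instance

/-- If all types that occur belong to `L`, then a vertex of type `S` which misses `i` has a
neighbour whose type belongs to `M`. -/
def ForcesNbr (H : Fin 4 → Fin 4 → Bool) (L : Finset (Finset (Fin 4))) (S : Finset (Fin 4))
    (i : Fin 4) (M : Finset (Finset (Fin 4))) : Prop :=
  i ∉ S ∧
  (∀ Z ∈ L, Compat H S Z → i ∈ Z → (∃ j ∈ S ∩ Z, H i j = true) → Z ∈ M) ∧
  (∀ Z ∈ L, Compat H S Z → i ∈ Z → ∀ Z' ∈ L, Compat H S Z' → i ∈ Z' → Compat H Z Z' →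
    Z ∈ M ∨ Z' ∈ M)

instance (H : Fin 4 → Fin 4 → Bool) (L : Finset (Finset (Fin 4))) (S : Finset (Fin 4)) (i : Fin 4)
    (M : Finset (Finset (Fin 4))) : Decidable (ForcesNbr H L S i M) := by
  unfold ForcesNbr
  have (Z : Finset (Fin 4)) : Decidable (∀ Z' ∈ L, Compat H S Z' → i ∈ Z' → Compat H Z Z' →
    Z ∈ M ∨ Z' ∈ M) := inferInstance
  infer_instance

/-! ### The link of a vertex of degree four, and what saturation says about types. -/

section Config

variable {V : Type*}

open Classical in
/-- The indices of the neighbours of `w` among the vertices `a i`. -/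
noncomputable def typ (G : SimpleGraph V) (a : Fin 4 → V) (w : V) : Finset (Fin 4) :=
  univ.filter fun i => G.Adj w (a i)

theorem mem_typ {G : SimpleGraph V} {a : Fin 4 → V} {w : V} {i : Fin 4} :
    i ∈ typ G a w ↔ G.Adj w (a i) := by
  simp [typ]

/-- `G` is a `K₄`-saturated graph, the neighbourhood of some vertex is `{a 0, a 1, a 2, a 3}`, and
`H` is the graph induced on it. -/
structure LinkConfig (G : SimpleGraph V) (H : Fin 4 → Fin 4 → Bool) (a : Fin 4 → V) : Prop where
  inj : Function.Injective a
  adj : ∀ i j, G.Adj (a i) (a j) ↔ H i j = true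
  cliqueFree : ∀ x y z w, G.Adj x y → G.Adj x z → G.Adj x w → G.Adj y z → G.Adj y w →
      G.Adj z w → False
  sat : ∀ x y, x ≠ y → ¬ G.Adj x y →
        ∃ p q, G.Adj p q ∧ G.Adj x p ∧ G.Adj x q ∧ G.Adj y p ∧ G.Adj y q
  apex : ∃ v, ∀ w, G.Adj v w ↔ w ∈ Set.range a

namespace LinkConfig

variable {G : SimpleGraph V} {H : Fin 4 → Fin 4 → Bool} {a : Fin 4 → V}

theorem comp_perm (hc : LinkConfig G H a) (σ : Equiv.Perm (Fin 4)) :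
    LinkConfig G (fun i j => H (σ i) (σ j)) (a ∘ σ) where
  inj := hc.inj.comp σ.injective
  adj i j := hc.adj _ _
  cliqueFree := hc.cliqueFree
  sat := hc.sat
  apex := by
    obtain ⟨v, hv⟩ := hc.apex
    exact ⟨v, fun w => by rw [hv, σ.surjective.range_comp]⟩

theorem exists_apex (hc : LinkConfig G H a) : ∃ v ∉ Set.range a, typ G a v = univ ∧
    ∀ w, G.Adj v w → w ∈ Set.range a := by
  obtain ⟨v, hv⟩ := hc.apex
  refine ⟨v, fun h => G.loopless.irrefl v ((hv v).2 h), ?_, fun w => (hv w).1⟩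
  ext i
  simp [mem_typ, hv]

theorem symm (hc : LinkConfig G H a) {i j : Fin 4} (h : H i j = true) : H j i = true := by
  rw [← hc.adj] at h ⊢
  exact h.symm

theorem irrefl (hc : LinkConfig G H a) (i : Fin 4) : H i i = false := by
  rw [← Bool.not_eq_true, ← hc.adj]
  exact G.loopless.irrefl _

theorem triangleFree (hc : LinkConfig G H a) {i j k : Fin 4} (h1 : H i j = true)
    (h2 : H i k = true) (h3 : H j k = true) : False := by
  obtain ⟨v, hv⟩ := hc.apex
  exact hc.cliqueFree v (a i) (a j) (a k) ((hv _).2 ⟨i, rfl⟩) ((hv _).2 ⟨j, rfl⟩)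
    ((hv _).2 ⟨k, rfl⟩) ((hc.adj _ _).2 h1) ((hc.adj _ _).2 h2) ((hc.adj _ _).2 h3)

/-- An edge of the link inside both types would complete `u` and `w` to a K₄. -/
theorem compat (hc : LinkConfig G H a) {u w : V} (h : G.Adj u w) :
    Compat H (typ G a u) (typ G a w) := by
  rintro ⟨i, hi, j, hj, hij⟩
  simp only [mem_inter, mem_typ] at hi hj
  exact hc.cliqueFree u w (a i) (a j) h hi.1 hj.1 hi.2 hj.2 ((hc.adj _ _).2 hij)

/-- A vertex outside the link that is not adjacent to the apex, or is the apex of a link with an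
edge, is adjacent to both ends of an edge of the link. -/
theorem spansEdge (hc : LinkConfig G H a) (hH : SpansEdge H univ) {w : V} (hw : w ∉ Set.range a) :
    SpansEdge H (typ G a w) := by
  obtain ⟨v, hv⟩ := hc.apex
  by_cases hwv : w = v
  · subst hwv
    have : typ G a w = univ := by
      ext i; simp [mem_typ, hv]
    rwa [this]
  · have hadj : ¬ G.Adj v w := fun h => hw ((hv w).1 h)
    obtain ⟨p, q, h1, h2, h3, h4, h5⟩ := hc.sat v w (Ne.symm hwv) hadj
    obtain ⟨i, rfl⟩ := (hv p).1 h2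
    obtain ⟨j, rfl⟩ := (hv q).1 h3
    exact ⟨i, mem_typ.2 h4, j, mem_typ.2 h5, (hc.adj _ _).1 h1⟩

/-- Saturation gives two adjacent common neighbours; the three cases correspond to two, one or none
of them lying in the link. -/
theorem nonadj_cases (hc : LinkConfig G H a) {u w : V} (huw : u ≠ w) (h : ¬ G.Adj u w) :
    SpansEdge H (typ G a u ∩ typ G a w) ∨
    (∃ z ∉ Set.range a, G.Adj z u ∧ G.Adj z w ∧ (typ G a u ∩ typ G a w ∩ typ G a z).Nonempty) ∨
    (∃ z ∉ Set.range a, ∃ z' ∉ Set.range a, G.Adj z z' ∧ G.Adj z u ∧ G.Adj z w ∧ G.Adj z' u ∧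
      G.Adj z' w) := by
  obtain ⟨p, q, h1, h2, h3, h4, h5⟩ := hc.sat u w huw h
  by_cases hp : p ∈ Set.range a
  · obtain ⟨i, rfl⟩ := hp
    by_cases hq : q ∈ Set.range a
    · obtain ⟨j, rfl⟩ := hq
      exact Or.inl ⟨i, by simp [mem_typ, h2, h4], j, by simp [mem_typ, h3, h5],
        (hc.adj _ _).1 h1⟩
    · exact Or.inr (Or.inl ⟨q, hq, h3.symm, h5.symm, i, by simp [mem_typ, h2, h4, h1.symm]⟩)
  · by_cases hq : q ∈ Set.range a
    · obtain ⟨j, rfl⟩ := hq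
      exact Or.inr (Or.inl ⟨p, hp, h2.symm, h4.symm, j, by simp [mem_typ, h3, h5, h1]⟩)
    · exact Or.inr (Or.inr ⟨p, hp, q, hq, h1, h2.symm, h4.symm, h3.symm, h5.symm⟩)

theorem mayBeNonadj (hc : LinkConfig G H a) {L : Finset (Finset (Fin 4))}
    (hL : ∀ w ∉ Set.range a, typ G a w ∈ L) {u w : V} (huw : u ≠ w) (h : ¬ G.Adj u w) :
    MayBeNonadj H L (typ G a u) (typ G a w) := by
  rcases hc.nonadj_cases huw h with h | ⟨z, hz, h1, h2, h3⟩ | ⟨z, hz, z', hz', h1, h2, h3, h4, h5⟩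
  · exact Or.inl h
  · exact Or.inr (Or.inl ⟨_, hL z hz, hc.compat h1, hc.compat h2, h3⟩)
  · exact Or.inr (Or.inr ⟨_, hL z hz, hc.compat h2, hc.compat h3, _, hL z' hz', hc.compat h4,
      hc.compat h5, hc.compat h1⟩)

/-- Saturation for `u` and `a i` gives adjacent common neighbours `p`, `q`. They are not both in the
link, since with `a i` they would form a triangle there. The two clauses of `ForcesNbr` treat
exactly one, or none, of them in the link. -/
theorem exists_nbr (hc : LinkConfig G H a) {L : Finset (Finset (Fin 4))}
    (hL : ∀ w ∉ Set.range a, typ G a w ∈ L) {S : Finset (Fin 4)} {i : Fin 4}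
    {M : Finset (Finset (Fin 4))} (hM : ForcesNbr H L S i M) {u : V}
    (hu : u ∉ Set.range a) (hS : typ G a u = S) :
    ∃ z ∉ Set.range a, G.Adj u z ∧ typ G a z ∈ M := by
  subst hS
  obtain ⟨hi, h1, h2⟩ := hM
  have hne : u ≠ a i := fun h => hu ⟨i, h.symm⟩
  obtain ⟨p, q, e1, e2, e3, e4, e5⟩ := hc.sat u (a i) hne (fun h => hi (mem_typ.2 h))
  by_cases hp : p ∈ Set.range a
  · obtain ⟨j, rfl⟩ := hp
    by_cases hq : q ∈ Set.range a
    · obtain ⟨k, rfl⟩ := hq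
      exact (hc.triangleFree ((hc.adj _ _).1 e4) ((hc.adj _ _).1 e5) ((hc.adj _ _).1 e1)).elim
    · exact ⟨q, hq, e3, h1 _ (hL q hq) (hc.compat e3) (mem_typ.2 e5.symm)
        ⟨j, by simp [mem_typ, e2, e1.symm], (hc.adj _ _).1 e4⟩⟩
  · by_cases hq : q ∈ Set.range a
    · obtain ⟨j, rfl⟩ := hq
      exact ⟨p, hp, e2, h1 _ (hL p hp) (hc.compat e2) (mem_typ.2 e4.symm)
        ⟨j, by simp [mem_typ, e3, e1], (hc.adj _ _).1 e5⟩⟩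
    · rcases h2 _ (hL p hp) (hc.compat e2) (mem_typ.2 e4.symm) _ (hL q hq) (hc.compat e3)
        (mem_typ.2 e5.symm) (hc.compat e1) with h | h
      · exact ⟨p, hp, e2, h⟩
      · exact ⟨q, hq, e3, h⟩

/-- Saturation for `a i` and `a j`; the absence of common neighbours in the link pushes both
witnesses outside. This is the source of nonempty classes. -/
theorem exists_pair (hc : LinkConfig G H a) {i j : Fin 4} (hij : i ≠ j) (h : H i j = false)
    (hk : ∀ k, ¬ (H i k = true ∧ H j k = true)) :
    ∃ z ∉ Set.range a, ∃ z' ∉ Set.range a, G.Adj z z' ∧ i ∈ typ G a z ∧ j ∈ typ G a z ∧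
      i ∈ typ G a z' ∧ j ∈ typ G a z' := by
  obtain ⟨p, q, e1, e2, e3, e4, e5⟩ := hc.sat (a i) (a j) (fun hh => hij (hc.inj hh))
    (fun hh => by rw [hc.adj, h] at hh; exact Bool.false_ne_true hh)
  refine ⟨p, ?_, q, ?_, e1, mem_typ.2 e2.symm, mem_typ.2 e4.symm, mem_typ.2 e3.symm,
    mem_typ.2 e5.symm⟩
  · rintro ⟨k, rfl⟩
    exact hk k ⟨(hc.adj _ _).1 e2, (hc.adj _ _).1 e4⟩
  · rintro ⟨k, rfl⟩
    exact hk k ⟨(hc.adj _ _).1 e3, (hc.adj _ _).1 e5⟩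

end LinkConfig

/-! ### Counting edges between two sets. -/

section Between

variable {G : SimpleGraph V}

open Classical in
/-- The edges between two sets of vertices, as ordered pairs. -/
noncomputable def between (G : SimpleGraph V) (X Y : Finset V) : Finset (V × V) :=
  (X ×ˢ Y).filter fun p => G.Adj p.1 p.2

theorem mem_between {X Y : Finset V} {p : V × V} :
    p ∈ between G X Y ↔ p.1 ∈ X ∧ p.2 ∈ Y ∧ G.Adj p.1 p.2 := by
  simp [between, and_assoc]

theorem card_between_complete {X Y : Finset V} (h : ∀ x ∈ X, ∀ y ∈ Y, G.Adj x y) :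
    (between G X Y).card = X.card * Y.card := by
  classical
  rw [← Finset.card_product]
  congr 1
  ext p
  rw [mem_between, mem_product]
  exact ⟨fun hp => ⟨hp.1, hp.2.1⟩, fun hp => ⟨hp.1, hp.2, h _ hp.1 _ hp.2⟩⟩

theorem card_between_comm (X Y : Finset V) :
    (between G X Y).card = (between G Y X).card := by
  classical
  refine Finset.card_bij (fun p _ => p.swap) ?_ ?_ ?_
  · rintro ⟨x, y⟩ h
    rw [mem_between] at h ⊢
    exact ⟨h.2.1, h.1, h.2.2.symm⟩
  · intro p _ q _ h
    exact Prod.swap_injective h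
  · rintro ⟨x, y⟩ h
    rw [mem_between] at h
    exact ⟨(y, x), mem_between.2 ⟨h.2.1, h.1, h.2.2.symm⟩, rfl⟩

theorem card_le_card_between {X Y : Finset V} (h : ∀ x ∈ X, ∃ y ∈ Y, G.Adj x y) :
    X.card ≤ (between G X Y).card := by
  classical
  have : X ⊆ (between G X Y).image Prod.fst := by
    intro x hx
    obtain ⟨y, hy, hxy⟩ := h x hx
    exact Finset.mem_image.2 ⟨(x, y), mem_between.2 ⟨hx, hy, hxy⟩, rfl⟩
  exact (Finset.card_le_card this).trans Finset.card_image_le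

end Between

/-! ### Counting triangles by their number of link vertices. -/

section Counting

variable [Fintype V]

open Classical in
/-- The vertices of type `S` outside the link. -/
noncomputable def cls (G : SimpleGraph V) (a : Fin 4 → V) (S : Finset (Fin 4)) : Finset V :=
  univ.filter fun w => w ∉ Set.range a ∧ typ G a w = S

open Classical in
/-- The triangles that avoid the link. -/
noncomputable def outerTriangles (G : SimpleGraph V) (a : Fin 4 → V) : Finset (Finset V) :=
  (triangles G).filter fun s => ∀ w ∈ s, w ∉ Set.range a

variable {G : SimpleGraph V} {H : Fin 4 → Fin 4 → Bool} {a : Fin 4 → V}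

theorem mem_cls {S : Finset (Fin 4)} {w : V} :
    w ∈ cls G a S ↔ w ∉ Set.range a ∧ typ G a w = S := by
  simp [cls]

theorem sum_cls (f : Finset (Fin 4) → ℕ) [DecidablePred fun w => w ∉ Set.range a] :
    ∑ w ∈ univ.filter (fun w => w ∉ Set.range a), f (typ G a w) =
      ∑ S, (cls G a S).card * f S := by
  classical
  rw [← Finset.sum_fiberwise _ (typ G a)]
  refine Finset.sum_congr rfl fun S _ => ?_
  have : (univ.filter (fun w => w ∉ Set.range a)).filter (fun w => typ G a w = S) =
      cls G a S := by
    ext w; simp [cls]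
  rw [this, Finset.sum_congr rfl (g := fun _ => f S), Finset.sum_const, smul_eq_mul]
  intro w hw
  rw [(mem_cls.1 hw).2]

theorem card_eq_sum_cls (hinj : Function.Injective a) :
    Fintype.card V = 4 + ∑ S, (cls G a S).card := by
  classical
  have h := sum_cls (G := G) (a := a) (fun _ => 1)
  simp only [Finset.sum_const, smul_eq_mul, mul_one] at h
  rw [← h]
  have h2 : (univ.filter (fun w => w ∈ Set.range a)).card = 4 := by
    have : univ.filter (fun w => w ∈ Set.range a) = univ.image a := by
      ext w; simp
    rw [this, Finset.card_image_of_injective _ hinj]; rfl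
  have h3 := Finset.card_filter_add_card_filter_not (s := (univ : Finset V))
    (fun w => w ∈ Set.range a)
  rw [Finset.card_univ] at h3
  omega

/-- The three terms count triangles with two, one and no vertices in the link, so nothing is counted
in two terms. The condition on `F` excludes a pair together with its reverse, and in particular
pairs of equal types, so every outer edge is counted in one direction only. -/
theorem sum_le_card_triangles (hc : LinkConfig G H a)
    (F : Finset (Finset (Fin 4) × Finset (Fin 4))) (hF : ∀ p ∈ F, p.swap ∉ F) :
    ∑ S, (cls G a S).card * (edgePairs H S).card +
      ∑ p ∈ F, (between G (cls G a p.1) (cls G a p.2)).card * (p.1 ∩ p.2).card +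
      (outerTriangles G a).card ≤ (triangles G).card := by
  classical
  let X2 : Finset (Σ _ : V, Fin 4 × Fin 4) :=
    (univ.filter (fun w => w ∉ Set.range a)).sigma fun w => edgePairs H (typ G a w)
  let X1 : Finset (Σ _ : Finset (Fin 4) × Finset (Fin 4), (V × V) × Fin 4) :=
    F.sigma fun p => between G (cls G a p.1) (cls G a p.2) ×ˢ (p.1 ∩ p.2)
  have hX2 : X2.card = ∑ S, (cls G a S).card * (edgePairs H S).card := by
    rw [Finset.card_sigma]
    exact sum_cls (fun S => (edgePairs H S).card)
  have hX1 : X1.card =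
      ∑ p ∈ F, (between G (cls G a p.1) (cls G a p.2)).card * (p.1 ∩ p.2).card := by
    rw [Finset.card_sigma]
    exact Finset.sum_congr rfl fun p _ => Finset.card_product _ _
  let f2 : (Σ _ : V, Fin 4 × Fin 4) → Finset V := fun x => {x.1, a x.2.1, a x.2.2}
  let f1 : (Σ _ : Finset (Fin 4) × Finset (Fin 4), (V × V) × Fin 4) → Finset V :=
    fun x => {x.2.1.1, x.2.1.2, a x.2.2}
  have m2 : ∀ x ∈ X2, x.1 ∉ Set.range a ∧ x.2.1 < x.2.2 ∧ H x.2.1 x.2.2 = true ∧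
      G.Adj x.1 (a x.2.1) ∧ G.Adj x.1 (a x.2.2) := by
    intro x hx
    simpa [X2, edgePairs, mem_typ, and_assoc] using hx
  have m1 : ∀ x ∈ X1, (typ G a x.2.1.1, typ G a x.2.1.2) = x.1 ∧ x.1 ∈ F ∧
      x.2.1.1 ∉ Set.range a ∧ x.2.1.2 ∉ Set.range a ∧
      G.Adj x.2.1.1 x.2.1.2 ∧ G.Adj x.2.1.1 (a x.2.2) ∧ G.Adj x.2.1.2 (a x.2.2) := by
    rintro ⟨p, ⟨u, w⟩, i⟩ hx
    simp only [X1, mem_sigma, mem_product, mem_between, mem_cls, mem_inter] at hx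
    obtain ⟨h1, ⟨⟨h2, h3⟩, ⟨h4, h5⟩, h6⟩, h7, h8⟩ := hx
    refine ⟨Prod.ext h3 h5, h1, h2, h4, h6, ?_, ?_⟩
    · rw [← h3] at h7; exact mem_typ.1 h7
    · rw [← h5] at h8; exact mem_typ.1 h8
  have inj2 : Set.InjOn f2 X2 := by
    rintro ⟨w, i, j⟩ hx ⟨w', i', j'⟩ hx' h
    obtain ⟨h1, h2, -⟩ := m2 _ hx
    obtain ⟨h1', h2', -⟩ := m2 _ hx'
    simp only [f2] at h h1 h2 h1' h2'
    have ew : w = w' := by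
      have : w ∈ ({w', a i', a j'} : Finset V) := by rw [← h]; simp
      simp only [mem_insert, mem_singleton] at this
      rcases this with e | e | e
      · exact e
      · exact (h1 ⟨_, e.symm⟩).elim
      · exact (h1 ⟨_, e.symm⟩).elim
    have ei : i = i' ∨ i = j' := by
      have : a i ∈ ({w', a i', a j'} : Finset V) := by rw [← h]; simp
      simp only [mem_insert, mem_singleton] at this
      rcases this with e | e | e
      · exact (h1' ⟨_, e⟩).elim
      · exact Or.inl (hc.inj e)
      · exact Or.inr (hc.inj e)
    have ej : j = i' ∨ j = j' := by
      have : a j ∈ ({w', a i', a j'} : Finset V) := by rw [← h]; simp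
      simp only [mem_insert, mem_singleton] at this
      rcases this with e | e | e
      · exact (h1' ⟨_, e⟩).elim
      · exact Or.inl (hc.inj e)
      · exact Or.inr (hc.inj e)
    have : i = i' ∧ j = j' := by omega
    obtain ⟨rfl, rfl⟩ := this
    rw [ew]
  have inj1 : Set.InjOn f1 X1 := by
    rintro ⟨p, ⟨u, w⟩, i⟩ hx ⟨p', ⟨u', w'⟩, i'⟩ hx' h
    obtain ⟨h1, h2, h3, h4, h5, -⟩ := m1 _ hx
    obtain ⟨h1', h2', h3', h4', h5', -⟩ := m1 _ hx'
    simp only [f1] at h h1 h2 h3 h4 h5 h1' h2' h3' h4' h5'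
    have ei : i = i' := by
      have : a i ∈ ({u', w', a i'} : Finset V) := by rw [← h]; simp
      simp only [mem_insert, mem_singleton] at this
      rcases this with e | e | e
      · exact (h3' ⟨_, e⟩).elim
      · exact (h4' ⟨_, e⟩).elim
      · exact hc.inj e
    have eu : u = u' ∨ u = w' := by
      have : u ∈ ({u', w', a i'} : Finset V) := by rw [← h]; simp
      simp only [mem_insert, mem_singleton] at this
      rcases this with e | e | e
      · exact Or.inl e
      · exact Or.inr e
      · exact (h3 ⟨_, e.symm⟩).elim
    have ew : w = u' ∨ w = w' := by
      have : w ∈ ({u', w', a i'} : Finset V) := by rw [← h]; simp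
      simp only [mem_insert, mem_singleton] at this
      rcases this with e | e | e
      · exact Or.inl e
      · exact Or.inr e
      · exact (h4 ⟨_, e.symm⟩).elim
    have hne := h5.ne
    rcases eu with rfl | rfl
    · rcases ew with rfl | rfl
      · exact (hne rfl).elim
      · rw [ei, ← h1, ← h1']
    · rcases ew with rfl | rfl
      · refine (hF _ h2 ?_).elim
        rw [← h1, Prod.swap_prod_mk, h1']
        exact h2'
      · exact (hne rfl).elim
  -- The number of link vertices of a triangle separates the three families.
  let g : Finset V → ℕ := fun s => (s.filter fun w => w ∈ Set.range a).card
  have c2 : ∀ s ∈ X2.image f2, g s = 2 ∧ s ∈ triangles G := by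
    intro s hs
    obtain ⟨⟨w, i, j⟩, hx, rfl⟩ := Finset.mem_image.1 hs
    obtain ⟨h1, h2, h3, h4, h5⟩ := m2 _ hx
    simp only [f2] at h1 h2 h3 h4 h5 ⊢
    refine ⟨?_, ?_⟩
    · have : a i ≠ a j := fun h => h2.ne (hc.inj h)
      simp only [g]
      rw [Finset.filter_insert, if_neg h1, Finset.filter_insert, if_pos ⟨i, rfl⟩,
        Finset.filter_singleton, if_pos ⟨j, rfl⟩, Finset.card_pair this]
    · rw [mem_triangles, SimpleGraph.is3Clique_triple_iff]
      exact ⟨h4, h5, (hc.adj _ _).2 h3⟩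
  have c1 : ∀ s ∈ X1.image f1, g s = 1 ∧ s ∈ triangles G := by
    intro s hs
    obtain ⟨⟨p, ⟨u, w⟩, i⟩, hx, rfl⟩ := Finset.mem_image.1 hs
    obtain ⟨-, -, h1, h2, h3, h4, h5⟩ := m1 _ hx
    simp only [f1] at h1 h2 h3 h4 h5 ⊢
    refine ⟨?_, ?_⟩
    · simp only [g]
      rw [Finset.filter_insert, if_neg h1, Finset.filter_insert, if_neg h2,
        Finset.filter_singleton, if_pos ⟨i, rfl⟩, Finset.card_singleton]
    · rw [mem_triangles, SimpleGraph.is3Clique_triple_iff]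
      exact ⟨h3, h4, h5⟩
  have c0 : ∀ s ∈ outerTriangles G a, g s = 0 ∧ s ∈ triangles G := by
    intro s hs
    simp only [outerTriangles, mem_filter] at hs
    refine ⟨?_, hs.1⟩
    simp only [g, Finset.card_eq_zero, Finset.filter_eq_empty_iff]
    exact hs.2
  have d21 : Disjoint (X2.image f2) (X1.image f1) := by
    rw [Finset.disjoint_left]
    intro s h h'
    have h1 := (c2 s h).1
    have h2 := (c1 s h').1
    omega
  have d0 : Disjoint (X2.image f2 ∪ X1.image f1) (outerTriangles G a) := by
    rw [Finset.disjoint_left]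
    intro s h h'
    have h2 := (c0 s h').1
    rcases Finset.mem_union.1 h with h | h
    · have h1 := (c2 s h).1
      omega
    · have h1 := (c1 s h).1
      omega
  rw [← hX2, ← hX1, ← Finset.card_image_of_injOn inj2, ← Finset.card_image_of_injOn inj1,
    ← Finset.card_union_of_disjoint d21, ← Finset.card_union_of_disjoint d0]
  refine Finset.card_le_card fun s hs => ?_
  rcases Finset.mem_union.1 hs with h | h
  · rcases Finset.mem_union.1 h with h | h
    · exact (c2 s h).2
    · exact (c1 s h).2
  · exact (c0 s h).2

end Counting

end Config

/-! ### Classification of the possible links. -/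

/-- Two disjoint edges. -/
def twoEdges (i j : Fin 4) : Bool :=
  decide ((i, j) ∈ [((0 : Fin 4), (1 : Fin 4)), (1, 0), (2, 3), (3, 2)])

/-- The path on four vertices. -/
def pathFour (i j : Fin 4) : Bool :=
  decide ((i, j) ∈ [((0 : Fin 4), (1 : Fin 4)), (1, 0), (1, 2), (2, 1), (2, 3), (3, 2)])

/-- The cycle on four vertices. -/
def cycleFour (i j : Fin 4) : Bool :=
  decide ((i, j) ∈ [((0 : Fin 4), (1 : Fin 4)), (1, 0), (1, 2), (2, 1), (2, 3), (3, 2), (3, 0),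
    (0, 3)])

/-- The star on four vertices, with centre `3`. -/
def starFour (i j : Fin 4) : Bool :=
  decide ((i, j) ∈ [((0 : Fin 4), (3 : Fin 4)), (3, 0), (1, 3), (3, 1), (2, 3), (3, 2)])

/-- Two non-adjacent vertices `i` and `j` of the link have a common neighbour in the link, or there
are two edges of the link neither of which is contained in the other one together with `i`, `j`. -/
def PairCondition (H : Fin 4 → Fin 4 → Bool) : Prop :=
  ∀ i j, i < j → H i j = false → (∃ k, H i k = true ∧ H j k = true) ∨
    ∃ p q, H p q = true ∧ ∃ p' q', H p' q' = true ∧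
      ¬ (p ∈ [i, j, p', q'] ∧ q ∈ [i, j, p', q']) ∧ ¬ (p' ∈ [i, j, p, q] ∧ q' ∈ [i, j, p, q])

instance (H : Fin 4 → Fin 4 → Bool) : Decidable (PairCondition H) := by
  unfold PairCondition; infer_instance

/-- The graph on four vertices with the given adjacencies. -/
def ofBools (b01 b02 b03 b12 b13 b23 : Bool) : Fin 4 → Fin 4 → Bool :=
  ![![false, b01, b02, b03], ![b01, false, b12, b13], ![b02, b12, false, b23],
    ![b03, b13, b23, false]]

-- The triangle-free graphs on four vertices that are not listed have an isolated vertex: no edge,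
-- one edge, or a path on three vertices. Pairing an isolated vertex with another vertex that shares
-- no neighbour with it, an end of the path if there is one, violates `PairCondition`.
set_option maxRecDepth 100000 in
theorem exists_perm_of_bools : ∀ b01 b02 b03 b12 b13 b23 : Bool,
    (∀ i j k, ¬ (ofBools b01 b02 b03 b12 b13 b23 i j = true ∧
      ofBools b01 b02 b03 b12 b13 b23 i k = true ∧
      ofBools b01 b02 b03 b12 b13 b23 j k = true)) →
    PairCondition (ofBools b01 b02 b03 b12 b13 b23) →
    ∃ σ : Equiv.Perm (Fin 4),
      (fun i j => ofBools b01 b02 b03 b12 b13 b23 (σ i) (σ j)) = twoEdges ∨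
      (fun i j => ofBools b01 b02 b03 b12 b13 b23 (σ i) (σ j)) = pathFour ∨
      (fun i j => ofBools b01 b02 b03 b12 b13 b23 (σ i) (σ j)) = cycleFour ∨
      (fun i j => ofBools b01 b02 b03 b12 b13 b23 (σ i) (σ j)) = starFour := by
  decide +kernel

namespace LinkConfig

variable {V : Type*} {G : SimpleGraph V} {H : Fin 4 → Fin 4 → Bool} {a : Fin 4 → V}

theorem eq_ofBools (hc : LinkConfig G H a) :
    H = ofBools (H 0 1) (H 0 2) (H 0 3) (H 1 2) (H 1 3) (H 2 3) := by
  have hs : ∀ i j, H i j = H j i := fun i j => by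
    rw [Bool.eq_iff_iff]
    exact ⟨hc.symm, hc.symm⟩
  funext i j
  fin_cases i <;> fin_cases j <;> simp [ofBools, hc.irrefl] <;> exact hs _ _

/-- The witnesses of `exists_pair` have types containing `i`, `j` and an edge each. If the edge of
one lay among `i`, `j` and the ends of the other edge, it would lie in both types, against `compat`.
-/
theorem pairCondition (hc : LinkConfig G H a) (hH : SpansEdge H univ) : PairCondition H := by
  intro i j hij h
  by_cases hk : ∃ k, H i k = true ∧ H j k = true
  · exact Or.inl hk
  · right
    obtain ⟨z, hz, z', hz', hzz, h1, h2, h3, h4⟩ := hc.exists_pair hij.ne h (not_exists.1 hk)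
    obtain ⟨p, hp, q, hq, hpq⟩ := hc.spansEdge hH hz
    obtain ⟨p', hp', q', hq', hpq'⟩ := hc.spansEdge hH hz'
    refine ⟨p, q, hpq, p', q', hpq', ?_, ?_⟩
    · rintro ⟨e1, e2⟩
      refine hc.compat hzz ⟨p, ?_, q, ?_, hpq⟩
      · simp only [List.mem_cons, List.not_mem_nil, or_false] at e1
        rcases e1 with rfl | rfl | rfl | rfl <;> simp [*]
      · simp only [List.mem_cons, List.not_mem_nil, or_false] at e2
        rcases e2 with rfl | rfl | rfl | rfl <;> simp [*]
    · rintro ⟨e1, e2⟩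
      refine hc.compat hzz ⟨p', ?_, q', ?_, hpq'⟩
      · simp only [List.mem_cons, List.not_mem_nil, or_false] at e1
        rcases e1 with rfl | rfl | rfl | rfl <;> simp [*]
      · simp only [List.mem_cons, List.not_mem_nil, or_false] at e2
        rcases e2 with rfl | rfl | rfl | rfl <;> simp [*]

/-- The link of a vertex of degree four is, up to the order of its vertices, a pair of disjoint
edges, a path, a cycle or a star. -/
theorem exists_comp_perm (hc : LinkConfig G H a) (hH : SpansEdge H univ) :
    ∃ b : Fin 4 → V, LinkConfig G twoEdges b ∨ LinkConfig G pathFour b ∨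
      LinkConfig G cycleFour b ∨ LinkConfig G starFour b := by
  have hp := hc.pairCondition hH
  have ht : ∀ i j k, ¬ (H i j = true ∧ H i k = true ∧ H j k = true) :=
    fun i j k h => hc.triangleFree h.1 h.2.1 h.2.2
  rw [hc.eq_ofBools] at hp ht
  obtain ⟨σ, h⟩ := exists_perm_of_bools _ _ _ _ _ _ ht hp
  rw [← hc.eq_ofBools] at h
  refine ⟨a ∘ σ, ?_⟩
  have hσ := hc.comp_perm σ
  rcases h with h | h | h | h <;> rw [h] at hσ
  · exact Or.inl hσ
  · exact Or.inr (Or.inl hσ)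
  · exact Or.inr (Or.inr (Or.inl hσ))
  · exact Or.inr (Or.inr (Or.inr hσ))

end LinkConfig

theorem exists_linkConfig {V : Type*} [Fintype V] {G : SimpleGraph V} [DecidableRel G.Adj]
    (hn : 6 ≤ Fintype.card V)
    (hG : IsGraphSaturated (SimpleGraph.completeGraph (Fin 4)) G) (hd : G.minDegree = 4) :
    ∃ b : Fin 4 → V, LinkConfig G twoEdges b ∨ LinkConfig G pathFour b ∨
      LinkConfig G cycleFour b ∨ LinkConfig G starFour b := by
  classical
  rw [isGraphSaturated_four_iff, cliqueFree_four_iff] at hG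
  have : Nonempty V := by
    rw [← Fintype.card_pos_iff]; omega
  obtain ⟨v, hv⟩ := G.exists_minimal_degree_vertex
  rw [hd] at hv
  have e : Fin 4 ≃ G.neighborFinset v :=
    (Fintype.equivFinOfCardEq (by
      rw [Fintype.card_coe, SimpleGraph.card_neighborFinset_eq_degree]; exact hv.symm)).symm
  let a : Fin 4 → V := fun i => e i
  have ha : ∀ w, G.Adj v w ↔ w ∈ Set.range a := by
    intro w
    rw [← SimpleGraph.mem_neighborFinset]
    constructor
    · intro hw
      exact ⟨e.symm ⟨w, hw⟩, by simp [a]⟩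
    · rintro ⟨i, rfl⟩
      exact (e i).2
  have hc : LinkConfig G (fun i j => decide (G.Adj (a i) (a j))) a :=
    { inj := fun i j h => e.injective (Subtype.ext h)
      adj := fun i j => by simp
      cliqueFree := hG.1
      sat := hG.2
      apex := ⟨v, ha⟩ }
  refine hc.exists_comp_perm ?_
  -- The closed neighbourhood of `v` has at most five vertices. A vertex outside it, by saturation
  -- against `v`, forces an edge in the link.
  obtain ⟨w, hw⟩ : ∃ w, w ∉ insert v (univ.image a) := by
    by_contra! h
    have h1 : (univ : Finset V) ⊆ insert v (univ.image a) := fun w _ => h w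
    have h2 := Finset.card_le_card h1
    have h3 := Finset.card_insert_le v (univ.image a)
    have h4 : (univ.image a).card ≤ 4 := Finset.card_image_le.trans (by simp)
    rw [Finset.card_univ] at h2
    omega
  simp only [mem_insert, mem_image, mem_univ, true_and, not_or, not_exists] at hw
  have hadj : ¬ G.Adj v w := fun h => by
    obtain ⟨i, hi⟩ := (ha w).1 h
    exact hw.2 i hi
  obtain ⟨p, q, h1, h2, h3, -, -⟩ := hG.2 v w (Ne.symm hw.1) hadj
  obtain ⟨i, rfl⟩ := (ha p).1 h2
  obtain ⟨j, rfl⟩ := (ha q).1 h3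
  exact ⟨i, mem_univ _, j, mem_univ _, by simpa using h1⟩

/-! ### Classes of outer vertices of equal type. -/

/-- The types that span an edge of `H`. -/
def edgeTypes (H : Fin 4 → Fin 4 → Bool) : Finset (Finset (Fin 4)) :=
  univ.filter fun S => SpansEdge H S

namespace LinkConfig

variable {V : Type*} {G : SimpleGraph V} {H : Fin 4 → Fin 4 → Bool} {a : Fin 4 → V}

theorem typ_mem_edgeTypes (hc : LinkConfig G H a) (hH : SpansEdge H univ) :
    ∀ w ∉ Set.range a, typ G a w ∈ edgeTypes H := by
  intro w hw
  simpa [edgeTypes] using hc.spansEdge hH hw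

/-- With an empty list of admissible neighbour types, `ForcesNbr` rules the type `S` out. -/
theorem typ_ne (hc : LinkConfig G H a) {L : Finset (Finset (Fin 4))}
    (hL : ∀ w ∉ Set.range a, typ G a w ∈ L) {S : Finset (Fin 4)} {i : Fin 4}
    (hM : ForcesNbr H L S i ∅) {u : V} (hu : u ∉ Set.range a) : typ G a u ≠ S := by
  intro h
  obtain ⟨z, -, -, hz⟩ := hc.exists_nbr hL hM hu h
  simp at hz

variable [Fintype V]

theorem exists_nbr_cls (hc : LinkConfig G H a) {L : Finset (Finset (Fin 4))}
    (hL : ∀ w ∉ Set.range a, typ G a w ∈ L) {S : Finset (Fin 4)} {i : Fin 4}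
    {M : Finset (Finset (Fin 4))} (hM : ForcesNbr H L S i M) {u : V} (hu : u ∈ cls G a S) :
    ∃ S' ∈ M, ∃ z ∈ cls G a S', G.Adj u z := by
  rw [mem_cls] at hu
  obtain ⟨z, hz, hz1, hz2⟩ := hc.exists_nbr hL hM hu.1 hu.2
  exact ⟨_, hz2, z, mem_cls.2 ⟨hz, rfl⟩, hz1⟩

theorem adj_of_cls (hc : LinkConfig G H a) {L : Finset (Finset (Fin 4))}
    (hL : ∀ w ∉ Set.range a, typ G a w ∈ L) {S S' : Finset (Fin 4)} (hSS : S ≠ S')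
    (hS : ¬ MayBeNonadj H L S S') {u w : V} (hu : u ∈ cls G a S) (hw : w ∈ cls G a S') :
    G.Adj u w := by
  rw [mem_cls] at hu hw
  by_contra h
  have hne : u ≠ w := by
    rintro rfl
    exact hSS (hu.2.symm.trans hw.2)
  have := hc.mayBeNonadj hL hne h
  rw [hu.2, hw.2] at this
  exact hS this

theorem card_between_cls (hc : LinkConfig G H a) {L : Finset (Finset (Fin 4))}
    (hL : ∀ w ∉ Set.range a, typ G a w ∈ L) {S S' : Finset (Fin 4)} (hSS : S ≠ S')
    (hS : ¬ MayBeNonadj H L S S') :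
    (between G (cls G a S) (cls G a S')).card = (cls G a S).card * (cls G a S').card :=
  card_between_complete fun _ hx _ hy => hc.adj_of_cls hL hSS hS hx hy

theorem cls_univ_pos (hc : LinkConfig G H a) : 0 < (cls G a univ).card := by
  obtain ⟨v, hv, hv', -⟩ := hc.exists_apex
  exact Finset.card_pos.2 ⟨v, mem_cls.2 ⟨hv, hv'⟩⟩

theorem exists_pair_cls (hc : LinkConfig G H a) {L : Finset (Finset (Fin 4))}
    (hL : ∀ w ∉ Set.range a, typ G a w ∈ L) {i j : Fin 4} (hij : i ≠ j) (h : H i j = false)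
    (hk : ∀ k, ¬ (H i k = true ∧ H j k = true)) :
    ∃ Z ∈ L, ∃ Z' ∈ L, Compat H Z Z' ∧ (i ∈ Z ∧ j ∈ Z ∧ i ∈ Z' ∧ j ∈ Z') ∧
      0 < (cls G a Z).card ∧ 0 < (cls G a Z').card := by
  obtain ⟨z, hz, z', hz', h1, h2, h3, h4, h5⟩ := hc.exists_pair hij h hk
  exact ⟨_, hL z hz, _, hL z' hz', hc.compat h1, ⟨h2, h3, h4, h5⟩,
    Finset.card_pos.2 ⟨z, mem_cls.2 ⟨hz, rfl⟩⟩, Finset.card_pos.2 ⟨z', mem_cls.2 ⟨hz', rfl⟩⟩⟩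

theorem sum_types {L : Finset (Finset (Fin 4))}
    (hL : ∀ w ∉ Set.range a, typ G a w ∈ L) (f : Finset (Fin 4) → ℕ) :
    ∑ S, (cls G a S).card * f S = ∑ S ∈ L, (cls G a S).card * f S := by
  symm
  refine Finset.sum_subset (subset_univ _) fun S _ hS => ?_
  have : cls G a S = ∅ := by
    ext w
    simp only [mem_cls, notMem_empty, iff_false, not_and]
    rintro hw rfl
    exact hS (hL w hw)
  rw [this]; simp

theorem card_eq_sum_types (hc : LinkConfig G H a) {L : Finset (Finset (Fin 4))}
    (hL : ∀ w ∉ Set.range a, typ G a w ∈ L) :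
    Fintype.card V = 4 + ∑ S ∈ L, (cls G a S).card := by
  have := sum_types hL (fun _ => 1)
  simp only [mul_one] at this
  rw [← this, ← card_eq_sum_cls hc.inj]

end LinkConfig

/-! ### The link consists of two disjoint edges: the extremal case. -/

section TwoEdges

/-- The types that can occur if the link consists of two disjoint edges. -/
def twoEdgesTypes : Finset (Finset (Fin 4)) :=
  {{0, 1, 2}, {0, 1, 3}, {0, 2, 3}, {1, 2, 3}, univ}

variable {V : Type*} {G : SimpleGraph V} {a : Fin 4 → V}

theorem typ_mem_twoEdgesTypes (hc : LinkConfig G twoEdges a) :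
    ∀ w ∉ Set.range a, typ G a w ∈ twoEdgesTypes := by
  have hL := hc.typ_mem_edgeTypes (by decide)
  intro w hw
  -- The witnesses for `w` and `a 2` would both lie outside the link. Their types omit 0 or 1, hence
  -- contain the edge 23, and two such types are incompatible.
  have h1 : typ G a w ≠ {0, 1} := hc.typ_ne hL (i := 2) (by decide +kernel) hw
  have h2 : typ G a w ≠ {2, 3} := hc.typ_ne hL (i := 0) (by decide +kernel) hw
  have key : ∀ S ∈ edgeTypes twoEdges, S ≠ {0, 1} → S ≠ {2, 3} → S ∈ twoEdgesTypes := by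
    decide +kernel
  exact key _ (hL w hw) h1 h2

theorem twoEdges_adj (hc : LinkConfig G twoEdges a) [Fintype V] {S S' : Finset (Fin 4)}
    (hS : S = {0, 1, 2} ∨ S = {0, 1, 3}) (hS' : S' = {0, 2, 3} ∨ S' = {1, 2, 3}) {u w : V}
    (hu : u ∈ cls G a S) (hw : w ∈ cls G a S') : G.Adj u w := by
  have hL := typ_mem_twoEdgesTypes hc
  refine hc.adj_of_cls hL ?_ ?_ hu hw <;>
  rcases hS with rfl | rfl <;> rcases hS' with rfl | rfl <;> decide +kernel

/-- The pairs 0, 2 and 1, 3 are non-adjacent without common neighbours in the link. In each case the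
only compatible types containing the pair are the two ways of adding a third index. -/
theorem twoEdges_cls_pos (hc : LinkConfig G twoEdges a) [Fintype V] :
    0 < (cls G a {0, 1, 2}).card ∧ 0 < (cls G a {0, 1, 3}).card ∧
    0 < (cls G a {0, 2, 3}).card ∧ 0 < (cls G a {1, 2, 3}).card := by
  have hL := typ_mem_twoEdgesTypes hc
  have h02 : 0 < (cls G a {0, 1, 2}).card ∧ 0 < (cls G a {0, 2, 3}).card := by
    obtain ⟨Z, hZ, Z', hZ', h1, h2, h3, h4⟩ :=
      hc.exists_pair_cls hL (i := 0) (j := 2) (by decide) (by decide) (by decide)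
    have key : ∀ Z ∈ twoEdgesTypes, ∀ Z' ∈ twoEdgesTypes, Compat twoEdges Z Z' →
        (0 ∈ Z ∧ 2 ∈ Z ∧ 0 ∈ Z' ∧ 2 ∈ Z') → (Z = {0, 1, 2} ∧ Z' = {0, 2, 3}) ∨
          (Z' = {0, 1, 2} ∧ Z = {0, 2, 3}) := by decide +kernel
    rcases key Z hZ Z' hZ' h1 h2 with ⟨rfl, rfl⟩ | ⟨rfl, rfl⟩
    · exact ⟨h3, h4⟩
    · exact ⟨h4, h3⟩
  have h13 : 0 < (cls G a {0, 1, 3}).card ∧ 0 < (cls G a {1, 2, 3}).card := by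
    obtain ⟨Z, hZ, Z', hZ', h1, h2, h3, h4⟩ :=
      hc.exists_pair_cls hL (i := 1) (j := 3) (by decide) (by decide) (by decide)
    have key : ∀ Z ∈ twoEdgesTypes, ∀ Z' ∈ twoEdgesTypes, Compat twoEdges Z Z' →
        (1 ∈ Z ∧ 3 ∈ Z ∧ 1 ∈ Z' ∧ 3 ∈ Z') → (Z = {0, 1, 3} ∧ Z' = {1, 2, 3}) ∨
          (Z' = {0, 1, 3} ∧ Z = {1, 2, 3}) := by decide +kernel
    rcases key Z hZ Z' hZ' h1 h2 with ⟨rfl, rfl⟩ | ⟨rfl, rfl⟩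
    · exact ⟨h3, h4⟩
    · exact ⟨h4, h3⟩
  exact ⟨h02.1, h13.1, h02.2, h13.2⟩

theorem twoEdges_card (hc : LinkConfig G twoEdges a) [Fintype V] :
    Fintype.card V = 4 + (cls G a {0, 1, 2}).card + (cls G a {0, 1, 3}).card +
      (cls G a {0, 2, 3}).card + (cls G a {1, 2, 3}).card + (cls G a univ).card := by
  rw [hc.card_eq_sum_types (typ_mem_twoEdgesTypes hc), twoEdgesTypes,
    Finset.sum_insert (by decide), Finset.sum_insert (by decide), Finset.sum_insert (by decide),
    Finset.sum_insert (by decide), Finset.sum_singleton]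
  ring

theorem twoEdges_le_card_triangles (hc : LinkConfig G twoEdges a) [Fintype V] :
    2 * (cls G a univ).card + (cls G a {0, 1, 2}).card + (cls G a {0, 1, 3}).card +
      (cls G a {0, 2, 3}).card + (cls G a {1, 2, 3}).card +
      2 * (((cls G a {0, 1, 2}).card + (cls G a {0, 1, 3}).card) *
        ((cls G a {0, 2, 3}).card + (cls G a {1, 2, 3}).card)) ≤ (triangles G).card := by
  have hL := typ_mem_twoEdgesTypes hc
  have h := sum_le_card_triangles hc
    {({0, 1, 2}, {0, 2, 3}), ({0, 1, 2}, {1, 2, 3}), ({0, 1, 3}, {0, 2, 3}),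
      ({0, 1, 3}, {1, 2, 3})} (by decide +kernel)
  rw [LinkConfig.sum_types hL, twoEdgesTypes,
    Finset.sum_insert (by decide), Finset.sum_insert (by decide), Finset.sum_insert (by decide),
    Finset.sum_insert (by decide), Finset.sum_singleton,
    Finset.sum_insert (by decide), Finset.sum_insert (by decide), Finset.sum_insert (by decide),
    Finset.sum_singleton,
    card_between_complete (fun _ hx _ hy => twoEdges_adj hc (by simp) (by simp) hx hy),
    card_between_complete (fun _ hx _ hy => twoEdges_adj hc (by simp) (by simp) hx hy),
    card_between_complete (fun _ hx _ hy => twoEdges_adj hc (by simp) (by simp) hx hy),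
    card_between_complete (fun _ hx _ hy => twoEdges_adj hc (by simp) (by simp) hx hy),
    show (edgePairs twoEdges {0, 1, 2}).card = 1 by decide +kernel,
    show (edgePairs twoEdges {0, 1, 3}).card = 1 by decide +kernel,
    show (edgePairs twoEdges {0, 2, 3}).card = 1 by decide +kernel,
    show (edgePairs twoEdges {1, 2, 3}).card = 1 by decide +kernel,
    show (edgePairs twoEdges univ).card = 2 by decide +kernel,
    show (({0, 1, 2} : Finset (Fin 4)) ∩ {0, 2, 3}).card = 2 by decide,
    show (({0, 1, 2} : Finset (Fin 4)) ∩ {1, 2, 3}).card = 2 by decide,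
    show (({0, 1, 3} : Finset (Fin 4)) ∩ {0, 2, 3}).card = 2 by decide,
    show (({0, 1, 3} : Finset (Fin 4)) ∩ {1, 2, 3}).card = 2 by decide] at h
  refine le_trans (le_of_eq ?_) ((Nat.le_add_right _ _).trans h)
  ring

/-- Write 2 + α and 2 + β for the numbers of vertices whose types are {0,1} and {2,3} plus one
index. The excess over 2n - 4 is at least 3α + 3β + 2αβ, so equality makes all four classes
singletons. -/
theorem twoEdges_bound (hc : LinkConfig G twoEdges a) [Fintype V] :
    2 * Fintype.card V - 4 ≤ (triangles G).card ∧
    ((triangles G).card = 2 * Fintype.card V - 4 → (cls G a {0, 1, 2}).card = 1 ∧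
      (cls G a {0, 1, 3}).card = 1 ∧ (cls G a {0, 2, 3}).card = 1 ∧
      (cls G a {1, 2, 3}).card = 1) := by
  have h1 := twoEdges_card hc
  have h2 := twoEdges_le_card_triangles hc
  obtain ⟨p1, p2, q1, q2⟩ := twoEdges_cls_pos hc
  generalize (cls G a {0, 1, 2}).card = x at *
  generalize (cls G a {0, 1, 3}).card = y at *
  generalize (cls G a {0, 2, 3}).card = z at *
  generalize (cls G a {1, 2, 3}).card = w at *
  generalize (cls G a univ).card = r at *
  obtain ⟨x, rfl⟩ := Nat.exists_eq_add_of_le p1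
  obtain ⟨y, rfl⟩ := Nat.exists_eq_add_of_le p2
  obtain ⟨z, rfl⟩ := Nat.exists_eq_add_of_le q1
  obtain ⟨w, rfl⟩ := Nat.exists_eq_add_of_le q2
  have h3 : 2 * ((1 + x + (1 + y)) * (1 + z + (1 + w))) =
      8 + 4 * (x + y) + 4 * (z + w) + 2 * ((x + y) * (z + w)) := by ring
  simp only [Nat.succ_eq_add_one, zero_add] at h1 h2 ⊢
  rw [h3] at h2
  constructor
  · omega
  · intro h4
    omega

end TwoEdges

/-! ### The link is a path. -/

section PathFour

/-- The types that can occur if the link is a path. -/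
def pathFourTypes : Finset (Finset (Fin 4)) :=
  {{1, 2}, {0, 1, 3}, {0, 2, 3}, {0, 1, 2}, {1, 2, 3}, univ}

variable {V : Type*} {G : SimpleGraph V} {a : Fin 4 → V}

theorem typ_mem_pathFourTypes (hc : LinkConfig G pathFour a) :
    ∀ w ∉ Set.range a, typ G a w ∈ pathFourTypes := by
  have hL := hc.typ_mem_edgeTypes (by decide)
  intro w hw
  have h1 : typ G a w ≠ {0, 1} := hc.typ_ne hL (i := 3) (by decide +kernel) hw
  have h2 : typ G a w ≠ {2, 3} := hc.typ_ne hL (i := 0) (by decide +kernel) hw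
  have key : ∀ S ∈ edgeTypes pathFour, S ≠ {0, 1} → S ≠ {2, 3} → S ∈ pathFourTypes := by
    decide +kernel
  exact key _ (hL w hw) h1 h2

/-- The ends 0 and 3 of the path force the classes {0,1,3} and {0,2,3} to be nonempty. These are
joined to each other and to enough other classes that the excess over 2n - 4 is at least n - 10. -/
theorem pathFour_bound (hc : LinkConfig G pathFour a) [Fintype V] (hn : 12 ≤ Fintype.card V) :
    2 * Fintype.card V - 4 < (triangles G).card := by
  have hL := typ_mem_pathFourTypes hc
  have hr := hc.cls_univ_pos
  have hxy : 0 < (cls G a {0, 1, 3}).card ∧ 0 < (cls G a {0, 2, 3}).card := by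
    obtain ⟨Z, hZ, Z', hZ', h1, h2, h3, h4⟩ :=
      hc.exists_pair_cls hL (i := 0) (j := 3) (by decide) (by decide) (by decide)
    have key : ∀ Z ∈ pathFourTypes, ∀ Z' ∈ pathFourTypes, Compat pathFour Z Z' →
        (0 ∈ Z ∧ 3 ∈ Z ∧ 0 ∈ Z' ∧ 3 ∈ Z') → (Z = {0, 1, 3} ∧ Z' = {0, 2, 3}) ∨
          (Z' = {0, 1, 3} ∧ Z = {0, 2, 3}) := by decide +kernel
    rcases key Z hZ Z' hZ' h1 h2 with ⟨rfl, rfl⟩ | ⟨rfl, rfl⟩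
    · exact ⟨h3, h4⟩
    · exact ⟨h4, h3⟩
  have h1 : Fintype.card V = 4 + _ := hc.card_eq_sum_types hL
  have h2 := sum_le_card_triangles hc
    {({1, 2}, {0, 1, 3}), ({1, 2}, {0, 2, 3}), ({0, 1, 3}, {0, 2, 3}), ({0, 1, 3}, {1, 2, 3}),
      ({0, 2, 3}, {0, 1, 2})} (by decide +kernel)
  rw [LinkConfig.sum_types hL, pathFourTypes,
    Finset.sum_insert (by decide), Finset.sum_insert (by decide), Finset.sum_insert (by decide),
    Finset.sum_insert (by decide), Finset.sum_insert (by decide), Finset.sum_singleton,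
    Finset.sum_insert (by decide), Finset.sum_insert (by decide), Finset.sum_insert (by decide),
    Finset.sum_insert (by decide), Finset.sum_singleton,
    hc.card_between_cls hL (S := {1, 2}) (S' := {0, 1, 3}) (by decide) (by decide +kernel),
    hc.card_between_cls hL (S := {1, 2}) (S' := {0, 2, 3}) (by decide) (by decide +kernel),
    hc.card_between_cls hL (S := {0, 1, 3}) (S' := {0, 2, 3}) (by decide) (by decide +kernel),
    hc.card_between_cls hL (S := {0, 1, 3}) (S' := {1, 2, 3}) (by decide) (by decide +kernel),
    hc.card_between_cls hL (S := {0, 2, 3}) (S' := {0, 1, 2}) (by decide) (by decide +kernel),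
    show (edgePairs pathFour {1, 2}).card = 1 by decide +kernel,
    show (edgePairs pathFour {0, 1, 3}).card = 1 by decide +kernel,
    show (edgePairs pathFour {0, 2, 3}).card = 1 by decide +kernel,
    show (edgePairs pathFour {0, 1, 2}).card = 2 by decide +kernel,
    show (edgePairs pathFour {1, 2, 3}).card = 2 by decide +kernel,
    show (edgePairs pathFour univ).card = 3 by decide +kernel,
    show (({1, 2} : Finset (Fin 4)) ∩ {0, 1, 3}).card = 1 by decide,
    show (({1, 2} : Finset (Fin 4)) ∩ {0, 2, 3}).card = 1 by decide,
    show (({0, 1, 3} : Finset (Fin 4)) ∩ {0, 2, 3}).card = 2 by decide,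
    show (({0, 1, 3} : Finset (Fin 4)) ∩ {1, 2, 3}).card = 2 by decide,
    show (({0, 2, 3} : Finset (Fin 4)) ∩ {0, 1, 2}).card = 2 by decide] at h2
  rw [pathFourTypes,
    Finset.sum_insert (by decide), Finset.sum_insert (by decide), Finset.sum_insert (by decide),
    Finset.sum_insert (by decide), Finset.sum_insert (by decide), Finset.sum_singleton] at h1
  obtain ⟨hx, hy⟩ := hxy
  generalize (cls G a {1, 2}).card = c at *
  generalize (cls G a {0, 1, 3}).card = x at *
  generalize (cls G a {0, 2, 3}).card = y at *
  generalize (cls G a {0, 1, 2}).card = s at *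
  generalize (cls G a {1, 2, 3}).card = t at *
  generalize (cls G a univ).card = r at *
  generalize (outerTriangles G a).card = o at *
  obtain ⟨x, rfl⟩ := Nat.exists_eq_add_of_le hx
  obtain ⟨y, rfl⟩ := Nat.exists_eq_add_of_le hy
  simp only [Nat.succ_eq_add_one, zero_add] at h1 h2
  ring_nf at h2
  have := Nat.zero_le (c * x)
  have := Nat.zero_le (c * y)
  have := Nat.zero_le (x * y)
  have := Nat.zero_le (x * t)
  have := Nat.zero_le (y * s)
  omega

end PathFour

/-! ### The link is a 4-cycle: arithmetic of class sizes. -/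

/-- The relations between the sizes of the classes in a configuration whose link is a 4-cycle: `s i`
vertices miss only `i`, `t i` vertices see exactly `i` and `i + 1`, `e i` edges join the classes
counted by `t i` and `t (i + 1)`, and `m` is the number of triangles. -/
structure CycleCounts (n m r s0 s1 s2 s3 t0 t1 t2 t3 e0 e1 e2 e3 o : ℕ) : Prop where
  card : n = 4 + r + (s0 + s1 + s2 + s3) + (t0 + t1 + t2 + t3)
  pos : 0 < r
  le : 4 * r + 2 * (s0 + s1 + s2 + s3) + (t0 + t1 + t2 + t3) + (e0 + e1 + e2 + e3) +
    (t0 * s0 + t0 * s1 + t1 * s1 + t1 * s2 + t2 * s2 + t2 * s3 + t3 * s3 + t3 * s0) +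
    2 * (s0 * s2) + 2 * (s1 * s3) + o ≤ m
  a0 : s0 = 0 → t0 ≤ e0
  a1 : s1 = 0 → t1 ≤ e1
  a2 : s2 = 0 → t2 ≤ e2
  a3 : s3 = 0 → t3 ≤ e3
  b0 : s2 = 0 → t1 ≤ e0
  b1 : s3 = 0 → t2 ≤ e1
  b2 : s0 = 0 → t3 ≤ e2
  b3 : s1 = 0 → t0 ≤ e3
  p0 : 0 < s0 → 0 < t0 + t3 + s2
  p1 : 0 < s1 → 0 < t1 + t0 + s3
  p2 : 0 < s2 → 0 < t2 + t1 + s0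
  p3 : 0 < s3 → 0 < t3 + t2 + s1
  u0 : 0 < e0 → 0 < t0 ∧ 0 < t1
  u1 : 0 < e1 → 0 < t1 ∧ 0 < t2
  u2 : 0 < e2 → 0 < t2 ∧ 0 < t3
  u3 : 0 < e3 → 0 < t3 ∧ 0 < t0
  outer : s0 = 0 → s1 = 0 → s2 = 0 → s3 = 0 → t0 + t1 + t2 + t3 ≤ 3 * o

namespace CycleCounts

variable {n m r s0 s1 s2 s3 t0 t1 t2 t3 e0 e1 e2 e3 o : ℕ}

theorem rotate (h : CycleCounts n m r s0 s1 s2 s3 t0 t1 t2 t3 e0 e1 e2 e3 o) :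
    CycleCounts n m r s1 s2 s3 s0 t1 t2 t3 t0 e1 e2 e3 e0 o where
  card := by rw [h.card]; ring
  pos := h.pos
  le := by
    refine le_trans (le_of_eq ?_) h.le
    ring
  a0 := h.a1
  a1 := h.a2
  a2 := h.a3
  a3 := h.a0
  b0 := h.b1
  b1 := h.b2
  b2 := h.b3
  b3 := h.b0
  p0 := h.p1
  p1 := h.p2
  p2 := h.p3
  p3 := h.p0
  u0 := h.u1
  u1 := h.u2
  u2 := h.u3
  u3 := h.u0
  outer i1 i2 i3 i0 := by
    have := h.outer i0 i1 i2 i3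
    omega

/-- With T the sum of the `t i`, the edges give at least T and the outer triangles at least T / 3,
so the excess is at least 2r + T / 3 - 4. -/
theorem bound_of_none (h : CycleCounts n m r 0 0 0 0 t0 t1 t2 t3 e0 e1 e2 e3 o) (hn : 14 ≤ n) :
    2 * n - 4 < m := by
  have h1 := h.card
  have h2 := h.le
  have := h.pos
  have := h.a0 rfl
  have := h.a1 rfl
  have := h.a2 rfl
  have := h.a3 rfl
  have := h.outer rfl rfl rfl rfl
  omega

theorem bound_of_one (h : CycleCounts n m r s0 0 0 0 t0 t1 t2 t3 e0 e1 e2 e3 o) (hn : 14 ≤ n)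
    (hs : 0 < s0) : 2 * n - 4 < m := by
  have h1 := h.card
  have h2 := h.le
  have := h.pos
  have := h.b0 rfl
  have := h.a1 rfl
  have := h.b1 rfl
  have := h.a2 rfl
  have := h.a3 rfl
  have := h.b3 rfl
  have hp := h.p0 hs
  obtain ⟨k, rfl⟩ := Nat.exists_eq_add_of_le hs
  simp only [Nat.succ_eq_add_one, zero_add] at h1 h2
  -- For `s0` = 1 the forced edges suffice. For `s0` = 2 + l the product (t0 + t3) * s0 also gains
  -- l, because t0 + t3 is positive.
  rcases Nat.eq_zero_or_pos k with rfl | hk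
  · ring_nf at h2
    omega
  · obtain ⟨l, rfl⟩ := Nat.exists_eq_add_of_le hk
    simp only [Nat.succ_eq_add_one, zero_add] at h1 h2
    have h3 : l ≤ (t0 + t3) * l := Nat.le_mul_of_pos_left l (by omega)
    ring_nf at h2 h3
    omega

theorem bound_of_two (h : CycleCounts n m r s0 s1 0 0 t0 t1 t2 t3 e0 e1 e2 e3 o) (hn : 14 ≤ n)
    (hs0 : 0 < s0) (hs1 : 0 < s1) : 2 * n - 4 < m := by
  have h1 := h.card
  have h2 := h.le
  have := h.pos
  have := h.b0 rfl
  have := h.b1 rfl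
  have := h.a2 rfl
  have := h.a3 rfl
  have := h.p0 hs0
  have := h.p1 hs1
  have := h.u3
  have := h.u0
  -- If `t0` were 0, then `p1` would give `t1` > 0, hence `e0` > 0 by `b0`, contradicting `u0`.
  have ht : 0 < t0 := by omega
  obtain ⟨p, rfl⟩ := Nat.exists_eq_add_of_le hs0
  obtain ⟨q, rfl⟩ := Nat.exists_eq_add_of_le hs1
  have h3 : p + q ≤ t0 * (p + q) := Nat.le_mul_of_pos_left _ ht
  simp only [Nat.succ_eq_add_one, zero_add] at h1 h2
  ring_nf at h2 h3
  have := Nat.zero_le (t1 * q)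
  have := Nat.zero_le (t3 * p)
  omega

/-- Each class `t i` is completely joined to the class of `s0` or of `s2`, which doubles its
contribution, and the product of `s0` and `s2` is at least s0 + s2 - 1. The small remaining deficit
is covered by forced edges or by the other two three-element types. -/
theorem bound_of_opposite (h : CycleCounts n m r s0 s1 s2 s3 t0 t1 t2 t3 e0 e1 e2 e3 o)
    (hn : 14 ≤ n) (hs0 : 0 < s0) (hs2 : 0 < s2) : 2 * n - 4 < m := by
  have h1 := h.card
  have h2 := h.le
  have hr := h.pos
  have k0 : t0 ≤ t0 * s0 := Nat.le_mul_of_pos_right _ hs0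
  have k1 : t1 ≤ t1 * s2 := Nat.le_mul_of_pos_right _ hs2
  have k2 : t2 ≤ t2 * s2 := Nat.le_mul_of_pos_right _ hs2
  have k3 : t3 ≤ t3 * s0 := Nat.le_mul_of_pos_right _ hs0
  have k4 : s0 + s2 ≤ s0 * s2 + 1 := by nlinarith
  have h3 := h.a1
  have h4 := h.a3
  have h5 := h.b1
  have h6 := h.b3
  have h7 := h.p1
  have h8 := h.p3
  rcases Nat.eq_zero_or_pos s1 with rfl | hs1
  · rcases Nat.eq_zero_or_pos s3 with rfl | hs3
    · simp only [mul_zero, add_zero] at h2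
      omega
    · have : t3 ≤ t3 * s3 := Nat.le_mul_of_pos_right _ hs3
      have : t2 ≤ t2 * s3 := Nat.le_mul_of_pos_right _ hs3
      omega
  · have : t0 ≤ t0 * s1 := Nat.le_mul_of_pos_right _ hs1
    have : t1 ≤ t1 * s1 := Nat.le_mul_of_pos_right _ hs1
    rcases Nat.eq_zero_or_pos s3 with rfl | hs3
    · omega
    · have : 0 < s1 * s3 := Nat.mul_pos hs1 hs3
      omega

theorem bound (h : CycleCounts n m r s0 s1 s2 s3 t0 t1 t2 t3 e0 e1 e2 e3 o)
    (hn : 14 ≤ n) : 2 * n - 4 < m := by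
  rcases Nat.eq_zero_or_pos s0 with rfl | h0 <;> rcases Nat.eq_zero_or_pos s1 with rfl | h1 <;>
  rcases Nat.eq_zero_or_pos s2 with rfl | h2 <;> rcases Nat.eq_zero_or_pos s3 with rfl | h3
  · exact h.bound_of_none hn
  · exact h.rotate.rotate.rotate.bound_of_one hn h3
  · exact h.rotate.rotate.bound_of_one hn h2
  · exact h.rotate.rotate.bound_of_two hn h2 h3
  · exact h.rotate.bound_of_one hn h1
  · exact h.rotate.bound_of_opposite hn h1 h3
  · exact h.rotate.bound_of_two hn h1 h2
  · exact h.rotate.bound_of_opposite hn h1 h3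
  · exact h.bound_of_one hn h0
  · exact h.rotate.rotate.rotate.bound_of_two hn h3 h0
  · exact h.bound_of_opposite hn h0 h2
  · exact h.bound_of_opposite hn h0 h2
  · exact h.bound_of_two hn h0 h1
  · exact h.rotate.bound_of_opposite hn h1 h3
  · exact h.bound_of_opposite hn h0 h2
  · exact h.bound_of_opposite hn h0 h2

end CycleCounts

/-! ### The link is a 4-cycle: structure of the classes. -/

section CycleFour

/-- The types that can occur if the link is a 4-cycle. -/
def cycleFourTypes : Finset (Finset (Fin 4)) :=
  {{1, 2, 3}, {0, 2, 3}, {0, 1, 3}, {0, 1, 2}, {0, 1}, {1, 2}, {2, 3}, {0, 3}, univ}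

/-- The types of size two. -/
def cycleFourEdges : Finset (Finset (Fin 4)) := {{0, 1}, {1, 2}, {2, 3}, {0, 3}}

variable {V : Type*} {G : SimpleGraph V} {a : Fin 4 → V}

theorem typ_mem_cycleFourTypes (hc : LinkConfig G cycleFour a) :
    ∀ w ∉ Set.range a, typ G a w ∈ cycleFourTypes := by
  have hL := hc.typ_mem_edgeTypes (by decide)
  intro w hw
  have key : ∀ S ∈ edgeTypes cycleFour, S ∈ cycleFourTypes := by decide +kernel
  exact key _ (hL w hw)

/-- The vertex `w` has neighbours `p`, `q` whose types are the two edges of the cycle next to its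
own. If they are not adjacent, they have adjacent common neighbours outside the link, of different
types, so one of these differs in type from `w`. Either it is adjacent to `w`, closing a triangle
with `p`, or it and `w` have adjacent common neighbours outside the link. -/
theorem exists_outerTriangle_of_cycleFour (hc : LinkConfig G cycleFour a) [Fintype V]
    (hL : ∀ w ∉ Set.range a, typ G a w ∈ insert univ cycleFourEdges) {w : V}
    (hw : w ∉ Set.range a) (hwt : typ G a w ∈ cycleFourEdges) :
    ∃ s ∈ outerTriangles G a, w ∈ s := by
  classical
  have tri : ∀ {x y z : V}, x ∉ Set.range a → y ∉ Set.range a → z ∉ Set.range a → G.Adj x y →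
      G.Adj x z → G.Adj y z → ∃ s ∈ outerTriangles G a, x ∈ s := by
    intro x y z hx hy hz h1 h2 h3
    refine ⟨{x, y, z}, ?_, by simp⟩
    simp only [outerTriangles, mem_filter, mem_triangles, SimpleGraph.is3Clique_triple_iff]
    refine ⟨⟨h1, h2, h3⟩, fun v hv => ?_⟩
    simp only [mem_insert, mem_singleton] at hv
    rcases hv with rfl | rfl | rfl <;> assumption
  -- This excludes the first two alternatives of `nonadj_cases`: non-adjacent vertices of different
  -- two-element types have both witnesses outside the link.
  have k1 : ∀ S ∈ cycleFourEdges, ∀ S' ∈ cycleFourEdges, S ≠ S' →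
      ¬ SpansEdge cycleFour (S ∩ S') ∧ ∀ Z ∈ insert univ cycleFourEdges, Compat cycleFour Z S →
        Compat cycleFour Z S' → ¬ (S ∩ S' ∩ Z).Nonempty := by decide +kernel
  have k2 : ∀ S ∈ cycleFourEdges, ∀ Z ∈ insert univ cycleFourEdges, Compat cycleFour Z S →
      Z ∈ cycleFourEdges ∧ Z ≠ S := by decide +kernel
  have step : ∀ {u v : V}, typ G a u ∈ cycleFourEdges → typ G a v ∈ cycleFourEdges →
      typ G a u ≠ typ G a v → ¬ G.Adj u v → ∃ z ∉ Set.range a, ∃ z' ∉ Set.range a, G.Adj z z' ∧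
        G.Adj z u ∧ G.Adj z v ∧ G.Adj z' u ∧ G.Adj z' v := by
    intro u v hu hv huv hadj
    obtain ⟨h1, h2⟩ := k1 _ hu _ hv huv
    rcases hc.nonadj_cases (fun h => huv (by rw [h])) hadj with h | ⟨z, hz, h3, h4, h5⟩ | h
    · exact (h1 h).elim
    · exact (h2 _ (hL z hz) (hc.compat h3) (hc.compat h4) h5).elim
    · exact h
  have edge : ∀ {z u : V}, z ∉ Set.range a → typ G a u ∈ cycleFourEdges → G.Adj z u →
      typ G a z ∈ cycleFourEdges ∧ typ G a z ≠ typ G a u := by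
    intro z u hz hu h
    exact k2 _ hu _ (hL z hz) (hc.compat h)
  have k3 : ∀ S ∈ cycleFourEdges, ∃ i j, ∃ M M', M ∈ cycleFourEdges ∧ M' ∈ cycleFourEdges ∧
      M ≠ M' ∧ ForcesNbr cycleFour (insert univ cycleFourEdges) S i {M} ∧
      ForcesNbr cycleFour (insert univ cycleFourEdges) S j {M'} := by
    intro S hS
    simp only [cycleFourEdges, mem_insert, mem_singleton] at hS
    rcases hS with rfl | rfl | rfl | rfl
    · exact ⟨2, 3, {1, 2}, {0, 3}, by decide +kernel⟩
    · exact ⟨3, 0, {2, 3}, {0, 1}, by decide +kernel⟩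
    · exact ⟨0, 1, {0, 3}, {1, 2}, by decide +kernel⟩
    · exact ⟨1, 2, {0, 1}, {2, 3}, by decide +kernel⟩
  obtain ⟨i, j, M, M', hM, hM', hMM, hi, hj⟩ := k3 _ hwt
  obtain ⟨p, hp, hwp, hpM⟩ := hc.exists_nbr hL hi hw rfl
  obtain ⟨q, hq, hwq, hqM⟩ := hc.exists_nbr hL hj hw rfl
  rw [mem_singleton] at hpM hqM
  by_cases hpq : G.Adj p q
  · exact tri hw hp hq hwp hwq hpq
  · have tp : typ G a p ∈ cycleFourEdges := by rwa [hpM]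
    have tq : typ G a q ∈ cycleFourEdges := by rwa [hqM]
    obtain ⟨z, hz, z', hz', h1, h2, h3, h4, h5⟩ := step tp tq (by rwa [hpM, hqM]) hpq
    have fin : ∀ {u : V}, u ∉ Set.range a → G.Adj u p → typ G a u ≠ typ G a w →
        ∃ s ∈ outerTriangles G a, w ∈ s := by
      intro u hu hup huw
      by_cases hwu : G.Adj w u
      · exact tri hw hu hp hwu hwp hup
      · obtain ⟨y, hy, y', hy', g1, g2, g3, g4, g5⟩ :=
          step hwt (edge hu tp hup).1 huw.symm hwu
        exact tri hw hy hy' g2.symm g4.symm g1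
    by_cases hzw : typ G a z = typ G a w
    · refine fin hz' h4 ?_
      rw [← hzw]
      exact (edge hz' (edge hz tp h2).1 h1.symm).2
    · exact fin hz h2 hzw

theorem card_pos_of_card_between_pos {X Y : Finset V} (h : 0 < (between G X Y).card) :
    0 < X.card ∧ 0 < Y.card := by
  obtain ⟨p, hp⟩ := Finset.card_pos.1 h
  rw [mem_between] at hp
  exact ⟨Finset.card_pos.2 ⟨_, hp.1⟩, Finset.card_pos.2 ⟨_, hp.2.1⟩⟩

theorem LinkConfig.card_cls_le_of_forcesNbr {H : Fin 4 → Fin 4 → Bool} (hc : LinkConfig G H a)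
    [Fintype V] {L : Finset (Finset (Fin 4))} (hL : ∀ w ∉ Set.range a, typ G a w ∈ L)
    {S M M' : Finset (Fin 4)} {i : Fin 4} (h : ForcesNbr H L S i {M, M'})
    (hM' : (cls G a M').card = 0) :
    (cls G a S).card ≤ (between G (cls G a S) (cls G a M)).card := by
  refine card_le_card_between fun u hu => ?_
  obtain ⟨T, hT, z, hz, huz⟩ := hc.exists_nbr_cls hL h hu
  rw [mem_insert, mem_singleton] at hT
  rcases hT with rfl | rfl
  · exact ⟨z, hz, huz⟩
  · rw [Finset.card_eq_zero] at hM'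
    simp [hM'] at hz

theorem LinkConfig.cls_pos_of_forcesNbr {H : Fin 4 → Fin 4 → Bool} (hc : LinkConfig G H a)
    [Fintype V] {L : Finset (Finset (Fin 4))} (hL : ∀ w ∉ Set.range a, typ G a w ∈ L)
    {S M M' M'' : Finset (Fin 4)} {i : Fin 4} (h : ForcesNbr H L S i {M, M', M''})
    (hS : 0 < (cls G a S).card) :
    0 < (cls G a M).card + (cls G a M').card + (cls G a M'').card := by
  obtain ⟨u, hu⟩ := Finset.card_pos.1 hS
  obtain ⟨T, hT, z, hz, -⟩ := hc.exists_nbr_cls hL h hu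
  have hz' : 0 < (cls G a T).card := Finset.card_pos.2 ⟨z, hz⟩
  rw [mem_insert, mem_insert, mem_singleton] at hT
  rcases hT with rfl | rfl | rfl <;> omega

/-- The outer triangles cover all vertices with two-element types, three at most each. -/
theorem cycleFour_le_outerTriangles (hc : LinkConfig G cycleFour a) [Fintype V]
    (h0 : (cls G a {1, 2, 3}).card = 0) (h1 : (cls G a {0, 2, 3}).card = 0)
    (h2 : (cls G a {0, 1, 3}).card = 0) (h3 : (cls G a {0, 1, 2}).card = 0) :
    (cls G a {0, 1}).card + (cls G a {1, 2}).card + (cls G a {2, 3}).card +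
      (cls G a {0, 3}).card ≤ 3 * (outerTriangles G a).card := by
  have hL : ∀ w ∉ Set.range a, typ G a w ∈ insert univ cycleFourEdges := by
    intro w hw
    have h := typ_mem_cycleFourTypes hc w hw
    have key : ∀ S ∈ cycleFourTypes, S ≠ {1, 2, 3} → S ≠ {0, 2, 3} → S ≠ {0, 1, 3} →
        S ≠ {0, 1, 2} → S ∈ insert univ cycleFourEdges := by decide +kernel
    have hne : ∀ S, (cls G a S).card = 0 → typ G a w ≠ S := by
      intro S hS hwS
      rw [Finset.card_eq_zero] at hS
      have : w ∈ cls G a S := mem_cls.2 ⟨hw, hwS⟩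
      simp [hS] at this
    exact key _ h (hne _ h0) (hne _ h1) (hne _ h2) (hne _ h3)
  classical
  have hsub : cycleFourEdges.biUnion (cls G a) ⊆ (outerTriangles G a).biUnion id := by
    intro w hw
    obtain ⟨S, hS, hwS⟩ := Finset.mem_biUnion.1 hw
    rw [mem_cls] at hwS
    obtain ⟨s, hs, hws⟩ := exists_outerTriangle_of_cycleFour hc hL hwS.1 (by rwa [hwS.2])
    exact Finset.mem_biUnion.2 ⟨s, hs, hws⟩
  have hcard := Finset.card_le_card hsub
  rw [Finset.card_biUnion] at hcard
  · rw [cycleFourEdges, Finset.sum_insert (by decide), Finset.sum_insert (by decide),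
      Finset.sum_insert (by decide), Finset.sum_singleton] at hcard
    have h3 : ((outerTriangles G a).biUnion id).card ≤ (outerTriangles G a).card * 3 := by
      refine Finset.card_biUnion_le_card_mul _ _ _ fun s hs => ?_
      simp only [outerTriangles, mem_filter, mem_triangles] at hs
      exact hs.1.card_eq.le
    omega
  · intro S _ S' _ hSS
    rw [Function.onFun, Finset.disjoint_left]
    intro w hw hw'
    rw [mem_cls] at hw hw'
    exact hSS (hw.2.symm.trans hw'.2)

theorem cycleFour_counts (hc : LinkConfig G cycleFour a) [Fintype V] :
    CycleCounts (Fintype.card V) (triangles G).card (cls G a univ).card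
      (cls G a {1, 2, 3}).card (cls G a {0, 2, 3}).card (cls G a {0, 1, 3}).card
      (cls G a {0, 1, 2}).card (cls G a {0, 1}).card (cls G a {1, 2}).card (cls G a {2, 3}).card
      (cls G a {0, 3}).card (between G (cls G a {0, 1}) (cls G a {1, 2})).card
      (between G (cls G a {1, 2}) (cls G a {2, 3})).card
      (between G (cls G a {2, 3}) (cls G a {0, 3})).card
      (between G (cls G a {0, 3}) (cls G a {0, 1})).card (outerTriangles G a).card := by
  have hL := typ_mem_cycleFourTypes hc
  refine
    { card := ?_
      pos := hc.cls_univ_pos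
      le := ?_
      a0 := hc.card_cls_le_of_forcesNbr hL (i := 2) (by decide +kernel)
      a1 := hc.card_cls_le_of_forcesNbr hL (i := 3) (by decide +kernel)
      a2 := hc.card_cls_le_of_forcesNbr hL (i := 0) (by decide +kernel)
      a3 := hc.card_cls_le_of_forcesNbr hL (i := 1) (by decide +kernel)
      b0 := fun h => (card_between_comm (G := G) _ _).symm ▸
        hc.card_cls_le_of_forcesNbr hL (i := 0) (by decide +kernel) h
      b1 := fun h => (card_between_comm (G := G) _ _).symm ▸
        hc.card_cls_le_of_forcesNbr hL (i := 1) (by decide +kernel) h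
      b2 := fun h => (card_between_comm (G := G) _ _).symm ▸
        hc.card_cls_le_of_forcesNbr hL (i := 2) (by decide +kernel) h
      b3 := fun h => (card_between_comm (G := G) _ _).symm ▸
        hc.card_cls_le_of_forcesNbr hL (i := 3) (by decide +kernel) h
      p0 := hc.cls_pos_of_forcesNbr hL (i := 0) (by decide +kernel)
      p1 := hc.cls_pos_of_forcesNbr hL (i := 1) (by decide +kernel)
      p2 := hc.cls_pos_of_forcesNbr hL (i := 2) (by decide +kernel)
      p3 := hc.cls_pos_of_forcesNbr hL (i := 3) (by decide +kernel)
      u0 := card_pos_of_card_between_pos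
      u1 := card_pos_of_card_between_pos
      u2 := card_pos_of_card_between_pos
      u3 := card_pos_of_card_between_pos
      outer := cycleFour_le_outerTriangles hc }
  · rw [hc.card_eq_sum_types hL, cycleFourTypes]
    repeat rw [Finset.sum_insert (by decide)]
    rw [Finset.sum_singleton]
    ring
  · have h := sum_le_card_triangles hc
      {({0, 1}, {1, 2}), ({1, 2}, {2, 3}), ({2, 3}, {0, 3}), ({0, 3}, {0, 1}),
        ({0, 1}, {1, 2, 3}), ({0, 1}, {0, 2, 3}), ({1, 2}, {0, 2, 3}), ({1, 2}, {0, 1, 3}),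
        ({2, 3}, {0, 1, 3}), ({2, 3}, {0, 1, 2}), ({0, 3}, {0, 1, 2}), ({0, 3}, {1, 2, 3}),
        ({1, 2, 3}, {0, 1, 3}), ({0, 2, 3}, {0, 1, 2})} (by decide +kernel)
    rw [LinkConfig.sum_types hL, cycleFourTypes] at h
    repeat rw [Finset.sum_insert (by decide +kernel)] at h
    rw [Finset.sum_singleton, Finset.sum_singleton,
      hc.card_between_cls hL (S := {0, 1}) (S' := {1, 2, 3}) (by decide) (by decide +kernel),
      hc.card_between_cls hL (S := {0, 1}) (S' := {0, 2, 3}) (by decide) (by decide +kernel),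
      hc.card_between_cls hL (S := {1, 2}) (S' := {0, 2, 3}) (by decide) (by decide +kernel),
      hc.card_between_cls hL (S := {1, 2}) (S' := {0, 1, 3}) (by decide) (by decide +kernel),
      hc.card_between_cls hL (S := {2, 3}) (S' := {0, 1, 3}) (by decide) (by decide +kernel),
      hc.card_between_cls hL (S := {2, 3}) (S' := {0, 1, 2}) (by decide) (by decide +kernel),
      hc.card_between_cls hL (S := {0, 3}) (S' := {0, 1, 2}) (by decide) (by decide +kernel),
      hc.card_between_cls hL (S := {0, 3}) (S' := {1, 2, 3}) (by decide) (by decide +kernel),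
      hc.card_between_cls hL (S := {1, 2, 3}) (S' := {0, 1, 3}) (by decide) (by decide +kernel),
      hc.card_between_cls hL (S := {0, 2, 3}) (S' := {0, 1, 2}) (by decide) (by decide +kernel),
      show (edgePairs cycleFour {1, 2, 3}).card = 2 by decide +kernel,
      show (edgePairs cycleFour {0, 2, 3}).card = 2 by decide +kernel,
      show (edgePairs cycleFour {0, 1, 3}).card = 2 by decide +kernel,
      show (edgePairs cycleFour {0, 1, 2}).card = 2 by decide +kernel,
      show (edgePairs cycleFour {0, 1}).card = 1 by decide +kernel,
      show (edgePairs cycleFour {1, 2}).card = 1 by decide +kernel,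
      show (edgePairs cycleFour {2, 3}).card = 1 by decide +kernel,
      show (edgePairs cycleFour {0, 3}).card = 1 by decide +kernel,
      show (edgePairs cycleFour univ).card = 4 by decide +kernel] at h
    simp only [
      show (({0, 1} : Finset (Fin 4)) ∩ {1, 2}).card = 1 by decide,
      show (({1, 2} : Finset (Fin 4)) ∩ {2, 3}).card = 1 by decide,
      show (({2, 3} : Finset (Fin 4)) ∩ {0, 3}).card = 1 by decide,
      show (({0, 3} : Finset (Fin 4)) ∩ {0, 1}).card = 1 by decide,
      show (({0, 1} : Finset (Fin 4)) ∩ {1, 2, 3}).card = 1 by decide,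
      show (({0, 1} : Finset (Fin 4)) ∩ {0, 2, 3}).card = 1 by decide,
      show (({1, 2} : Finset (Fin 4)) ∩ {0, 2, 3}).card = 1 by decide,
      show (({1, 2} : Finset (Fin 4)) ∩ {0, 1, 3}).card = 1 by decide,
      show (({2, 3} : Finset (Fin 4)) ∩ {0, 1, 3}).card = 1 by decide,
      show (({2, 3} : Finset (Fin 4)) ∩ {0, 1, 2}).card = 1 by decide,
      show (({0, 3} : Finset (Fin 4)) ∩ {0, 1, 2}).card = 1 by decide,
      show (({0, 3} : Finset (Fin 4)) ∩ {1, 2, 3}).card = 1 by decide,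
      show (({1, 2, 3} : Finset (Fin 4)) ∩ {0, 1, 3}).card = 2 by decide,
      show (({0, 2, 3} : Finset (Fin 4)) ∩ {0, 1, 2}).card = 2 by decide] at h
    refine le_trans (le_of_eq ?_) h
    ring

theorem cycleFour_bound (hc : LinkConfig G cycleFour a) [Fintype V] (hn : 14 ≤ Fintype.card V) :
    2 * Fintype.card V - 4 < (triangles G).card :=
  (cycleFour_counts hc).bound hn

end CycleFour

/-! ### The link is a star: arithmetic of class sizes. -/

/-- The relations between the sizes of the classes in a configuration whose link is a star: `n i`
vertices see only the leaf `i` and the centre, `d i` vertices miss only the leaf `i`, `e i j` edges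
join the classes counted by `n i` and `n j`, and `m` is the number of triangles. -/
structure StarCounts (N m r n0 n1 n2 d0 d1 d2 e01 e02 e12 : ℕ) : Prop where
  card : N = 4 + r + (n0 + n1 + n2) + (d0 + d1 + d2)
  pos : 0 < r
  le : 3 * r + 2 * (d0 + d1 + d2) + (n0 + n1 + n2) + (n0 * d0 + n1 * d1 + n2 * d2) +
    (e01 + e02 + e12) ≤ m
  n0_pos : 0 < d0 → 0 < n0
  n1_pos : 0 < d1 → 0 < n1
  n2_pos : 0 < d2 → 0 < n2
  z01 : d0 = 0 → n0 ≤ e01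
  z02 : d0 = 0 → n0 ≤ e02
  z10 : d1 = 0 → n1 ≤ e01
  z12 : d1 = 0 → n1 ≤ e12
  z20 : d2 = 0 → n2 ≤ e02
  z21 : d2 = 0 → n2 ≤ e12
  h0 : d0 = 1 → n0 ≤ e01 + e02
  h1 : d1 = 1 → n1 ≤ e01 + e12
  h2 : d2 = 1 → n2 ≤ e02 + e12
  s0 : d0 = 0 → 0 < n0 → n1 + n2 + 2 * n0 ≤ e01 + e02 + e12 + 2
  s1 : d1 = 0 → 0 < n1 → n0 + n2 + 2 * n1 ≤ e01 + e02 + e12 + 2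
  s2 : d2 = 0 → 0 < n2 → n0 + n1 + 2 * n2 ≤ e01 + e02 + e12 + 2
  c01 : n2 = 0 → e01 = n0 * n1
  c02 : n1 = 0 → e02 = n0 * n2
  c12 : n0 = 0 → e12 = n1 * n2
  u01 : 0 < e01 → 0 < n0 ∧ 0 < n1
  u02 : 0 < e02 → 0 < n0 ∧ 0 < n2
  u12 : 0 < e12 → 0 < n1 ∧ 0 < n2
  two0 : d0 = 1 → d1 = 0 → d2 = 0 → 0 < n1 → 2 ≤ n0
  two1 : d1 = 1 → d0 = 0 → d2 = 0 → 0 < n0 → 2 ≤ n1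
  two2 : d2 = 1 → d0 = 0 → d1 = 0 → 0 < n0 → 2 ≤ n2
  gen : d0 = 0 → d1 = 0 → d2 = 0 → 2 * (n0 + n1 + n2) ≤ e01 + e02 + e12 + 6 ∨
    3 * (n0 + n1 + n2) ≤ 2 * (e01 + e02 + e12)

/-- This is (n - 1)(d - 2) ≥ 0. -/
theorem two_mul_add_le_mul_add_two {n d : ℕ} (hn : 0 < n) (hd : 2 ≤ d) :
    2 * n + d ≤ n * d + 2 := by
  obtain ⟨k, rfl⟩ := Nat.exists_eq_add_of_le hd
  have := Nat.le_mul_of_pos_left k hn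
  rw [mul_add]
  omega

namespace StarCounts

variable {N m r n0 n1 n2 d0 d1 d2 e01 e02 e12 : ℕ}

theorem swap (h : StarCounts N m r n0 n1 n2 d0 d1 d2 e01 e02 e12) :
    StarCounts N m r n1 n0 n2 d1 d0 d2 e01 e12 e02 where
  card := by rw [h.card]; ring
  pos := h.pos
  le := by
    refine le_trans (le_of_eq ?_) h.le
    ring
  n0_pos := h.n1_pos
  n1_pos := h.n0_pos
  n2_pos := h.n2_pos
  z01 := h.z10
  z02 := h.z12
  z10 := h.z01
  z12 := h.z02
  z20 := h.z21
  z21 := h.z20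
  h0 := h.h1
  h1 := h.h0
  h2 := fun i => by have := h.h2 i; omega
  s0 := fun i j => by have := h.s1 i j; omega
  s1 := fun i j => by have := h.s0 i j; omega
  s2 := fun i j => by have := h.s2 i j; omega
  c01 := fun i => by rw [h.c01 i, mul_comm]
  c02 := h.c12
  c12 := h.c02
  u01 := fun i => (h.u01 i).symm
  u02 := h.u12
  u12 := h.u02
  two0 := h.two1
  two1 := h.two0
  -- The field `two2` asks for a vertex in one particular leaf class. When the classes `d0`, `d1`
  -- are empty, each of the leaf classes 0 and 1 being nonempty forces the other.
  two2 := fun i j k l => by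
    refine h.two2 i k j ?_
    have := h.z12 j
    have := h.u12
    have := h.n2_pos
    have := h.z10 j
    have := h.u01
    omega
  gen := fun i j k => by
    have := h.gen j i k
    omega

theorem rotate (h : StarCounts N m r n0 n1 n2 d0 d1 d2 e01 e02 e12) :
    StarCounts N m r n1 n2 n0 d1 d2 d0 e12 e01 e02 where
  card := by rw [h.card]; ring
  pos := h.pos
  le := by
    refine le_trans (le_of_eq ?_) h.le
    ring
  n0_pos := h.n1_pos
  n1_pos := h.n2_pos
  n2_pos := h.n0_pos
  z01 := h.z12
  z02 := h.z10
  z10 := h.z21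
  z12 := h.z20
  z20 := h.z01
  z21 := h.z02
  h0 := fun i => by have := h.h1 i; omega
  h1 := fun i => by have := h.h2 i; omega
  h2 := h.h0
  s0 := fun i j => by have := h.s1 i j; omega
  s1 := fun i j => by have := h.s2 i j; omega
  s2 := fun i j => by have := h.s0 i j; omega
  c01 := h.c12
  c02 := fun i => by rw [h.c01 i, mul_comm]
  c12 := fun i => by rw [h.c02 i, mul_comm]
  u01 := h.u12
  u02 := fun i => (h.u01 i).symm
  u12 := fun i => (h.u02 i).symm
  two0 := fun i j k l => by
    refine h.two1 i k j ?_
    have := h.z20 j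
    have := h.u02
    omega
  two1 := fun i j k l => by
    refine h.two2 i k j ?_
    have := h.z10 j
    have := h.u01
    omega
  two2 := fun i j k l => by
    exact h.two0 i j k l
  gen := fun i j k => by
    have := h.gen k i j
    omega

/-- In the first alternative of `gen` the excess is at least r + n0 + n1 + n2 - 10 = N - 14; this is
one source of the thresholds 14 and 15. -/
theorem bound_of_none (h : StarCounts N m r n0 n1 n2 0 0 0 e01 e02 e12) (hN : 14 ≤ N) :
    2 * N - 4 ≤ m ∧ (15 ≤ N → 2 * N - 4 < m) := by
  have := h.card
  have h2 := h.le
  have := h.pos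
  have := h.gen rfl rfl rfl
  simp only [mul_zero, add_zero] at h2
  omega

/-- For `d0` ≥ 2 the product n0 * d0 is large enough. For `d0` = 1 the degree condition `h0` makes
the other leaf classes nonempty; then `s1`, `s2` bound the number of edges and `two0` supplies a
second vertex in the leaf class 0. -/
theorem bound_of_one (h : StarCounts N m r n0 n1 n2 d0 0 0 e01 e02 e12) (hd : 0 < d0)
    (hN : 14 ≤ N) : 2 * N - 4 ≤ m ∧ (15 ≤ N → 2 * N - 4 < m) := by
  have := h.card
  have h2 := h.le
  have := h.pos
  have hn0 := h.n0_pos hd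
  have := h.z10 rfl
  have := h.z12 rfl
  have := h.z20 rfl
  have := h.z21 rfl
  have := h.u01
  have := h.u02
  have := h.u12
  simp only [mul_zero, add_zero] at h2
  rcases Nat.lt_or_ge d0 2 with hd1 | hd1
  · obtain rfl : d0 = 1 := by omega
    have := h.h0 rfl
    have := h.s1 rfl
    have := h.s2 rfl
    have := h.two0 rfl rfl rfl
    omega
  · have := two_mul_add_le_mul_add_two hn0 (by assumption : 2 ≤ d0)
    omega

theorem bound_of_two (h : StarCounts N m r n0 n1 n2 d0 d1 0 e01 e02 e12) (hd0 : 0 < d0)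
    (hd1 : 0 < d1) (hdd : d0 = 1 ∨ 2 ≤ d1) (hN : 14 ≤ N) :
    2 * N - 4 ≤ m ∧ (15 ≤ N → 2 * N - 4 < m) := by
  have := h.card
  have h2 := h.le
  have := h.pos
  have hn0 := h.n0_pos hd0
  have hn1 := h.n1_pos hd1
  have := h.z20 rfl
  have := h.z21 rfl
  have := h.h0
  have := h.s2 rfl
  simp only [mul_zero, add_zero] at h2
  rcases Nat.lt_or_ge d1 2 with hd | hd
  · obtain rfl : d1 = 1 := by omega
    obtain rfl : d0 = 1 := by omega
    rcases Nat.eq_zero_or_pos n2 with rfl | hn2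
    · have := h.c01 rfl
      have : n0 + n1 ≤ n0 * n1 + 1 := by nlinarith
      omega
    · omega
  · have := two_mul_add_le_mul_add_two hn1 hd
    rcases Nat.lt_or_ge d0 2 with hd' | hd'
    · obtain rfl : d0 = 1 := by omega
      omega
    · have := two_mul_add_le_mul_add_two hn0 (by assumption : 2 ≤ d0)
      omega

theorem bound_of_three (h : StarCounts N m r n0 n1 n2 d0 d1 d2 e01 e02 e12) (hd0 : 0 < d0)
    (hd1 : 0 < d1) (hd2 : 0 < d2) (hN : 14 ≤ N) :
    2 * N - 4 ≤ m ∧ (15 ≤ N → 2 * N - 4 < m) := by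
  have := h.card
  have h2 := h.le
  have := h.pos
  -- Summed over the three leaves, with `e` the number of edges leaving each leaf class, every edge
  -- is counted twice, as is every product n i * d i.
  have k : ∀ n d e : ℕ, 0 < n → 0 < d → (d = 1 → n ≤ e) →
      3 * n + d ≤ 2 * (n * d) + e + 1 := by
    intro n d e hn hd he
    rcases Nat.lt_or_ge d 2 with hd1 | hd1
    · obtain rfl : d = 1 := by omega
      have := he rfl
      omega
    · have := two_mul_add_le_mul_add_two hn hd1
      omega
  have := k n0 d0 _ (h.n0_pos hd0) hd0 h.h0
  have := k n1 d1 _ (h.n1_pos hd1) hd1 h.h1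
  have := k n2 d2 _ (h.n2_pos hd2) hd2 h.h2
  omega

theorem bound (h : StarCounts N m r n0 n1 n2 d0 d1 d2 e01 e02 e12) (hN : 14 ≤ N) :
    2 * N - 4 ≤ m ∧ (15 ≤ N → 2 * N - 4 < m) := by
  have two : ∀ {n0 n1 n2 d0 d1 e01 e02 e12 : ℕ},
      StarCounts N m r n0 n1 n2 d0 d1 0 e01 e02 e12 → 0 < d0 → 0 < d1 →
      2 * N - 4 ≤ m ∧ (15 ≤ N → 2 * N - 4 < m) := by
    intro n0 n1 n2 d0 d1 e01 e02 e12 h hd0 hd1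
    by_cases hd : 2 ≤ d1
    · exact h.bound_of_two hd0 hd1 (Or.inr hd) hN
    · exact h.swap.bound_of_two hd1 hd0 (Or.inl (by omega)) hN
  rcases Nat.eq_zero_or_pos d0 with rfl | h0 <;> rcases Nat.eq_zero_or_pos d1 with rfl | h1 <;>
  rcases Nat.eq_zero_or_pos d2 with rfl | h2
  · exact h.bound_of_none hN
  · exact h.rotate.rotate.bound_of_one h2 hN
  · exact h.rotate.bound_of_one h1 hN
  · exact two h.rotate h1 h2
  · exact h.bound_of_one h0 hN
  · exact two h.rotate.rotate h2 h0
  · exact two h h0 h1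
  · exact h.bound_of_three h0 h1 h2 hN

end StarCounts

/-! ### Edge estimates for triangle-free tripartite graphs. -/

section Degrees

variable {V : Type*} {G : SimpleGraph V}

open Classical in
/-- The neighbours of `x` in `Y`. -/
noncomputable def nbrs (G : SimpleGraph V) (x : V) (Y : Finset V) : Finset V :=
  Y.filter fun y => G.Adj x y

theorem mem_nbrs {x y : V} {Y : Finset V} : y ∈ nbrs G x Y ↔ y ∈ Y ∧ G.Adj x y := by
  simp [nbrs]

theorem card_between_eq_sum (X Y : Finset V) :
    (between G X Y).card = ∑ x ∈ X, (nbrs G x Y).card := by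
  classical
  rw [between, Finset.card_filter, Finset.sum_product]
  refine Finset.sum_congr rfl fun x _ => ?_
  rw [nbrs, Finset.card_filter]

/-- If every vertex of `Y ∪ Z` not adjacent to `x` has a common neighbour with `x` in the other one
of these two sets, then there are many edges between `Y` and `Z`. -/
theorem card_add_card_le_between {x : V} {Y Z : Finset V}
    (hY : ∀ y ∈ Y, ¬ G.Adj x y → ∃ z ∈ Z, G.Adj x z ∧ G.Adj y z)
    (hZ : ∀ z ∈ Z, ¬ G.Adj x z → ∃ y ∈ Y, G.Adj x y ∧ G.Adj z y) :
    Y.card + Z.card ≤ (between G Y Z).card + (nbrs G x Y).card + (nbrs G x Z).card := by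
  classical
  have h1 : (Y.filter fun y => ¬ G.Adj x y).card ≤
      (between G (Y.filter fun y => ¬ G.Adj x y) Z).card := by
    refine card_le_card_between fun y hy => ?_
    rw [mem_filter] at hy
    obtain ⟨z, hz, -, h⟩ := hY y hy.1 hy.2
    exact ⟨z, hz, h⟩
  have h2 : (Z.filter fun z => ¬ G.Adj x z).card ≤
      (between G (Z.filter fun z => ¬ G.Adj x z) (nbrs G x Y)).card := by
    refine card_le_card_between fun z hz => ?_
    rw [mem_filter] at hz
    obtain ⟨y, hy, h, h'⟩ := hZ z hz.1 hz.2
    exact ⟨y, mem_nbrs.2 ⟨hy, h⟩, h'⟩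
  have h3 : (between G (Z.filter fun z => ¬ G.Adj x z) (nbrs G x Y)).card ≤
      (between G (nbrs G x Y) Z).card := by
    rw [card_between_comm (nbrs G x Y) Z]
    refine Finset.card_le_card fun p hp => ?_
    rw [mem_between] at hp ⊢
    exact ⟨(mem_filter.1 hp.1).1, hp.2⟩
  -- Edges are split by whether their end in `Y` is a neighbour of `x`: the first part pays for the
  -- non-neighbours of `x` in `Z`, the second for those in `Y`.
  have h4 : (between G Y Z).card = (between G (nbrs G x Y) Z).card +
      (between G (Y.filter fun y => ¬ G.Adj x y) Z).card := by
    rw [card_between_eq_sum, card_between_eq_sum, card_between_eq_sum, nbrs,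
      Finset.sum_filter_add_sum_filter_not]
  have h5 : (nbrs G x Y).card + (Y.filter fun y => ¬ G.Adj x y).card = Y.card := by
    rw [nbrs, Finset.card_filter_add_card_filter_not]
  have h6 : (nbrs G x Z).card + (Z.filter fun z => ¬ G.Adj x z).card = Z.card := by
    rw [nbrs, Finset.card_filter_add_card_filter_not]
  omega

/-- Three independent sets such that each vertex has a neighbour in each of the other two, two
non-adjacent vertices of different sets have a common neighbour in the third one, and there is no
triangle. -/
structure Tripartite (G : SimpleGraph V) (X Y Z : Finset V) : Prop where
  free : ∀ x ∈ X, ∀ y ∈ Y, ∀ z ∈ Z, G.Adj x y → G.Adj x z → G.Adj y z → False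
  xy : ∀ x ∈ X, ∃ y ∈ Y, G.Adj x y
  xz : ∀ x ∈ X, ∃ z ∈ Z, G.Adj x z
  yx : ∀ y ∈ Y, ∃ x ∈ X, G.Adj y x
  yz : ∀ y ∈ Y, ∃ z ∈ Z, G.Adj y z
  zx : ∀ z ∈ Z, ∃ x ∈ X, G.Adj z x
  zy : ∀ z ∈ Z, ∃ y ∈ Y, G.Adj z y
  commonX : ∀ y ∈ Y, ∀ z ∈ Z, ¬ G.Adj y z → ∃ x ∈ X, G.Adj y x ∧ G.Adj z x
  commonY : ∀ x ∈ X, ∀ z ∈ Z, ¬ G.Adj x z → ∃ y ∈ Y, G.Adj x y ∧ G.Adj z y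
  commonZ : ∀ x ∈ X, ∀ y ∈ Y, ¬ G.Adj x y → ∃ z ∈ Z, G.Adj x z ∧ G.Adj y z

namespace Tripartite

variable {X Y Z : Finset V}

theorem rotate (h : Tripartite G X Y Z) : Tripartite G Y Z X where
  free y hy z hz x hx h1 h2 h3 := h.free x hx y hy z hz h2.symm h3.symm h1
  xy := h.yz
  xz := h.yx
  yx := h.zy
  yz := h.zx
  zx := h.xy
  zy := h.xz
  commonX z hz x hx h1 := by
    obtain ⟨y, hy, h2, h3⟩ := h.commonY x hx z hz (fun h' => h1 h'.symm)
    exact ⟨y, hy, h3, h2⟩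
  commonY y hy x hx h1 := by
    obtain ⟨z, hz, h2, h3⟩ := h.commonZ x hx y hy (fun h' => h1 h'.symm)
    exact ⟨z, hz, h3, h2⟩
  commonZ := h.commonX

theorem one_le_card_nbrs (h : Tripartite G X Y Z) {x : V} (hx : x ∈ X) :
    1 ≤ (nbrs G x Y).card ∧ 1 ≤ (nbrs G x Z).card := by
  obtain ⟨y, hy, hxy⟩ := h.xy x hx
  obtain ⟨z, hz, hxz⟩ := h.xz x hx
  exact ⟨Finset.card_pos.2 ⟨y, mem_nbrs.2 ⟨hy, hxy⟩⟩, Finset.card_pos.2 ⟨z, mem_nbrs.2 ⟨hz, hxz⟩⟩⟩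

/-- Let `y`, `z` be the only neighbours of `x`. Common neighbours with `x` must be these, so `y` is
joined to all of `Z` but `z`, and `z` to all of `Y` but `y`. This gives |Y| + |Z| - 2 edges. A
vertex `w` of `X` adjacent to neither `y` nor `z` gives, via `card_add_card_le_between` on the
remaining sets, |Y| + |Z| - 2 more, counting its own edges; the other vertices of `X` have degree at
least 2. The total falls short of twice the number of vertices by at most 6. -/
theorem le_of_card_nbrs_eq_two (h : Tripartite G X Y Z) {x : V} (hx : x ∈ X)
    (h2 : (nbrs G x Y).card + (nbrs G x Z).card = 2) :
    2 * (X.card + Y.card + Z.card) ≤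
      (between G X Y).card + (between G X Z).card + (between G Y Z).card + 6 := by
  classical
  have h1 := h.one_le_card_nbrs hx
  obtain ⟨y, hNy⟩ := Finset.card_eq_one.1 (show (nbrs G x Y).card = 1 by omega)
  obtain ⟨z, hNz⟩ := Finset.card_eq_one.1 (show (nbrs G x Z).card = 1 by omega)
  have hy : y ∈ Y ∧ G.Adj x y := mem_nbrs.1 (by rw [hNy]; simp)
  have hz : z ∈ Z ∧ G.Adj x z := mem_nbrs.1 (by rw [hNz]; simp)
  have uy : ∀ y' ∈ Y, G.Adj x y' → y' = y := fun y' h1 h2 => by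
    have : y' ∈ nbrs G x Y := mem_nbrs.2 ⟨h1, h2⟩
    rwa [hNy, mem_singleton] at this
  have uz : ∀ z' ∈ Z, G.Adj x z' → z' = z := fun z' h1 h2 => by
    have : z' ∈ nbrs G x Z := mem_nbrs.2 ⟨h1, h2⟩
    rwa [hNz, mem_singleton] at this
  have hyz : ¬ G.Adj y z := fun h' => h.free x hx y hy.1 z hz.1 hy.2 hz.2 h'
  have ay : ∀ z' ∈ Z.erase z, G.Adj y z' := by
    intro z' hz'
    rw [mem_erase] at hz'
    obtain ⟨y', hy', e1, e2⟩ := h.commonY x hx z' hz'.2 (fun h' => hz'.1 (uz z' hz'.2 h'))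
    rw [uy y' hy' e1] at e2
    exact e2.symm
  have az : ∀ y' ∈ Y.erase y, G.Adj y' z := by
    intro y' hy'
    rw [mem_erase] at hy'
    obtain ⟨z', hz', e1, e2⟩ := h.commonZ x hx y' hy'.2 (fun h' => hy'.1 (uy y' hy'.2 h'))
    rwa [uz z' hz' e1] at e2
  -- A neighbour `w` of some neighbour `z1` of `y` avoids `y`, as there is no triangle. It avoids
  -- `z` too, since its neighbours in `Y` differ from `y` and so are adjacent to `z`.
  obtain ⟨z1, hz1, hyz1⟩ := h.yz y hy.1
  obtain ⟨w, hw, hz1w⟩ := h.zx z1 hz1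
  have hwy : ¬ G.Adj w y := fun h' => h.free w hw y hy.1 z1 hz1 h' hz1w.symm hyz1
  have hwz : ¬ G.Adj w z := by
    intro h'
    obtain ⟨y1, hy1, hwy1⟩ := h.xy w hw
    have hne : y1 ≠ y := fun e => hwy (e ▸ hwy1)
    exact h.free w hw y1 hy1 z hz.1 hwy1 h' (az y1 (mem_erase.2 ⟨hne, hy1⟩))
  have hcore : (Y.erase y).card + (Z.erase z).card ≤
      (between G (Y.erase y) (Z.erase z)).card + (nbrs G w (Y.erase y)).card +
        (nbrs G w (Z.erase z)).card := by
    refine card_add_card_le_between ?_ ?_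
    · intro y' hy' hwy'
      obtain ⟨z', hz', e1, e2⟩ := h.commonZ w hw y' (mem_of_mem_erase hy') hwy'
      exact ⟨z', mem_erase.2 ⟨fun e => hwz (e ▸ e1), hz'⟩, e1, e2⟩
    · intro z' hz' hwz'
      obtain ⟨y', hy', e1, e2⟩ := h.commonY w hw z' (mem_of_mem_erase hz') hwz'
      exact ⟨y', mem_erase.2 ⟨fun e => hwy (e ▸ e1), hy'⟩, e1, e2⟩
  have hYZ : (Z.erase z).card + ((Y.erase y).card +
      (between G (Y.erase y) (Z.erase z)).card) ≤ (between G Y Z).card := by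
    rw [card_between_eq_sum Y Z, ← Finset.add_sum_erase _ _ hy.1]
    refine Nat.add_le_add (Finset.card_le_card fun z' hz' => mem_nbrs.2
      ⟨mem_of_mem_erase hz', ay z' hz'⟩) ?_
    rw [card_between_eq_sum, Finset.card_eq_sum_ones, ← Finset.sum_add_distrib]
    refine Finset.sum_le_sum fun y' hy' => ?_
    have : insert z (nbrs G y' (Z.erase z)) ⊆ nbrs G y' Z := by
      intro z' hz'
      rcases mem_insert.1 hz' with rfl | hz'
      · exact mem_nbrs.2 ⟨hz.1, az y' hy'⟩
      · rw [mem_nbrs] at hz' ⊢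
        exact ⟨mem_of_mem_erase hz'.1, hz'.2⟩
    have h' := Finset.card_le_card this
    rw [Finset.card_insert_of_notMem (by simp [mem_nbrs])] at h'
    omega
  have hX : (nbrs G w Y).card + (nbrs G w Z).card + 2 * (X.erase w).card ≤
      (between G X Y).card + (between G X Z).card := by
    rw [card_between_eq_sum, card_between_eq_sum, ← Finset.sum_add_distrib,
      ← Finset.add_sum_erase _ _ hw, mul_comm, ← smul_eq_mul]
    refine Nat.add_le_add le_rfl (Finset.card_nsmul_le_sum _ _ _ fun x' hx' => ?_)
    have := h.one_le_card_nbrs (mem_of_mem_erase hx')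
    omega
  have m1 : (nbrs G w (Y.erase y)).card ≤ (nbrs G w Y).card := by
    refine Finset.card_le_card fun v hv => ?_
    rw [mem_nbrs] at hv ⊢
    exact ⟨mem_of_mem_erase hv.1, hv.2⟩
  have m2 : (nbrs G w (Z.erase z)).card ≤ (nbrs G w Z).card := by
    refine Finset.card_le_card fun v hv => ?_
    rw [mem_nbrs] at hv ⊢
    exact ⟨mem_of_mem_erase hv.1, hv.2⟩
  rw [Finset.card_erase_of_mem hy.1, Finset.card_erase_of_mem hz.1] at hcore hYZ
  rw [Finset.card_erase_of_mem hw] at hX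
  have := Finset.card_pos.2 ⟨y, hy.1⟩
  have := Finset.card_pos.2 ⟨z, hz.1⟩
  have := Finset.card_pos.2 ⟨w, hw⟩
  omega

/-- Either some vertex has degree 2, or all degrees are at least 3 and the degree sum gives the
second bound. -/
theorem le_or_le (h : Tripartite G X Y Z) :
    2 * (X.card + Y.card + Z.card) ≤
      (between G X Y).card + (between G X Z).card + (between G Y Z).card + 6 ∨
    3 * (X.card + Y.card + Z.card) ≤
      2 * ((between G X Y).card + (between G X Z).card + (between G Y Z).card) := by
  have key : ∀ {X Y Z : Finset V}, Tripartite G X Y Z →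
      (2 * (X.card + Y.card + Z.card) ≤
        (between G X Y).card + (between G X Z).card + (between G Y Z).card + 6) ∨
      3 * X.card ≤ (between G X Y).card + (between G X Z).card := by
    intro X Y Z h
    by_cases hx : ∃ x ∈ X, (nbrs G x Y).card + (nbrs G x Z).card = 2
    · obtain ⟨x, hx, h2⟩ := hx
      exact Or.inl (h.le_of_card_nbrs_eq_two hx h2)
    · right
      rw [card_between_eq_sum, card_between_eq_sum, ← Finset.sum_add_distrib, mul_comm,
        ← smul_eq_mul]
      refine Finset.card_nsmul_le_sum _ _ _ fun x hx' => ?_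
      have h1 := h.one_le_card_nbrs hx'
      have h2 : (nbrs G x Y).card + (nbrs G x Z).card ≠ 2 := fun e => hx ⟨x, hx', e⟩
      omega
  have k1 := key h
  have k2 := key h.rotate
  have k3 := key h.rotate.rotate
  have c1 := card_between_comm (G := G) X Y
  have c2 := card_between_comm (G := G) X Z
  have c3 := card_between_comm (G := G) Y Z
  omega

end Tripartite

end Degrees

/-! ### The link is a star: structure of the classes. -/

section Star

/-- The types that can occur if the link is a star. -/
def starFourTypes : Finset (Finset (Fin 4)) :=
  {{0, 3}, {1, 3}, {2, 3}, {1, 2, 3}, {0, 2, 3}, {0, 1, 3}, univ}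

/-- A leaf-type `S` for the star: a vertex of type `S` can only be adjacent to vertices of types
`S'`, `S''` and `D` outside the link, and vertices of two of the types `S`, `S'`, `S''` can only have
common neighbours of the third type outside the link. -/
def LeafTypes (S S' S'' D : Finset (Fin 4)) : Prop :=
  S.card = 2 ∧ (∀ Z ∈ starFourTypes, Compat starFour S Z → Z = S' ∨ Z = S'' ∨ Z = D) ∧
  3 ∈ S ∧ 3 ∈ S' ∧ 3 ∈ S'' ∧
  ¬ SpansEdge starFour (S ∩ S') ∧ ¬ SpansEdge starFour (S ∩ S'') ∧
  (∀ Z ∈ starFourTypes, Compat starFour Z S → Compat starFour Z S' → Z = S'') ∧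
  (∀ Z ∈ starFourTypes, Compat starFour Z S → Compat starFour Z S'' → Z = S')

instance (S S' S'' D : Finset (Fin 4)) : Decidable (LeafTypes S S' S'' D) := by
  unfold LeafTypes; infer_instance

variable {V : Type*} {G : SimpleGraph V} {a : Fin 4 → V}

theorem typ_mem_starFourTypes (hc : LinkConfig G starFour a) :
    ∀ w ∉ Set.range a, typ G a w ∈ starFourTypes := by
  have hL := hc.typ_mem_edgeTypes (by decide)
  intro w hw
  have key : ∀ S ∈ edgeTypes starFour, S ∈ starFourTypes := by decide +kernel
  exact key _ (hL w hw)

/-- The centre would complete the triangle to a K₄. Every outer type contains the centre, so this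
applies to all outer vertices. -/
theorem starFour_no_triangle (hc : LinkConfig G starFour a) {x y z : V} (hx : 3 ∈ typ G a x)
    (hy : 3 ∈ typ G a y) (hz : 3 ∈ typ G a z) (h1 : G.Adj x y) (h2 : G.Adj x z)
    (h3 : G.Adj y z) : False := by
  rw [mem_typ] at hx hy hz
  exact hc.cliqueFree x y z (a 3) h1 h2 hx h3 hy hz

variable [Fintype V]

theorem starFour_common (hc : LinkConfig G starFour a) {S S' S'' : Finset (Fin 4)}
    (hne : ¬ SpansEdge starFour (S ∩ S')) (hSS : S ≠ S')
    (hZ : ∀ Z ∈ starFourTypes, Compat starFour Z S → Compat starFour Z S' → Z = S'') {x y : V}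
    (hx : x ∈ cls G a S) (hy : y ∈ cls G a S') (hxy : ¬ G.Adj x y) :
    ∃ z ∈ cls G a S'', G.Adj x z ∧ G.Adj y z := by
  rw [mem_cls] at hx hy
  have hL := typ_mem_starFourTypes hc
  have fin : ∀ z ∉ Set.range a, G.Adj z x → G.Adj z y →
      ∃ z ∈ cls G a S'', G.Adj x z ∧ G.Adj y z := by
    intro z hz h1 h2
    refine ⟨z, mem_cls.2 ⟨hz, hZ _ (hL z hz) ?_ ?_⟩, h1.symm, h2.symm⟩
    · rw [← hx.2]; exact hc.compat h1
    · rw [← hy.2]; exact hc.compat h2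
  rcases hc.nonadj_cases (fun h => hSS (by rw [← hx.2, ← hy.2, h])) hxy with
    h | ⟨z, hz, h1, h2, -⟩ | ⟨z, hz, -, -, -, h1, h2, -⟩
  · rw [hx.2, hy.2] at h
    exact (hne h).elim
  · exact fin z hz h1 h2
  · exact fin z hz h1 h2

-- Only two neighbours of `x` lie in the link, and outside it the type allows just the classes `S'`,
-- `S''` and `D`.
open Classical in
theorem starFour_degree (hc : LinkConfig G starFour a)
    (hdeg : ∀ w, 4 ≤ (univ.filter fun v => G.Adj w v).card) {S S' S'' D : Finset (Fin 4)}
    (hS : LeafTypes S S' S'' D) {x : V} (hx : x ∈ cls G a S) :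
    2 ≤ (nbrs G x (cls G a S')).card + (nbrs G x (cls G a S'')).card + (cls G a D).card := by
  have hL := typ_mem_starFourTypes hc
  obtain ⟨h1, h2, -⟩ := hS
  rw [mem_cls] at hx
  have hsub : (univ.filter fun v => G.Adj x v) ⊆
      ((S.image a ∪ nbrs G x (cls G a S')) ∪ nbrs G x (cls G a S'')) ∪ cls G a D := by
    intro v hv
    have hv : G.Adj x v := by simpa using hv
    simp only [mem_union, mem_image, mem_nbrs, mem_cls]
    by_cases hva : v ∈ Set.range a
    · obtain ⟨i, rfl⟩ := hva
      exact Or.inl (Or.inl (Or.inl ⟨i, by rw [← hx.2, mem_typ]; exact hv, rfl⟩))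
    · have hcmp := hc.compat hv
      rw [hx.2] at hcmp
      rcases h2 _ (hL v hva) hcmp with h | h | h
      · exact Or.inl (Or.inl (Or.inr ⟨⟨hva, h⟩, hv⟩))
      · exact Or.inl (Or.inr ⟨⟨hva, h⟩, hv⟩)
      · exact Or.inr ⟨hva, h⟩
  have h3 := (hdeg x).trans (Finset.card_le_card hsub)
  have h4 := Finset.card_union_le ((S.image a ∪ nbrs G x (cls G a S')) ∪
    nbrs G x (cls G a S'')) (cls G a D)
  have h5 := Finset.card_union_le (S.image a ∪ nbrs G x (cls G a S')) (nbrs G x (cls G a S''))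
  have h6 := Finset.card_union_le (S.image a) (nbrs G x (cls G a S'))
  have h7 : (S.image a).card ≤ S.card := Finset.card_image_le
  omega

theorem starFour_card_le_between (hc : LinkConfig G starFour a)
    (hdeg : ∀ w, 4 ≤ (nbrs G w univ).card) {S S' S'' D : Finset (Fin 4)}
    (hS : LeafTypes S S' S'' D) (hD : (cls G a D).card = 1) :
    (cls G a S).card ≤ (between G (cls G a S) (cls G a S')).card +
      (between G (cls G a S) (cls G a S'')).card := by
  rw [card_between_eq_sum, card_between_eq_sum, ← Finset.sum_add_distrib,
    Finset.card_eq_sum_ones]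
  refine Finset.sum_le_sum fun x hx => ?_
  have := starFour_degree hc hdeg hS hx
  omega

/-- Fix `x` of type `S`. Non-neighbours of `x` in one of the classes `S'`, `S''` share with it a
neighbour in the other, so `card_add_card_le_between` applies; every other vertex of type `S` has at
least two neighbours in these classes. -/
theorem starFour_card_add_le_between (hc : LinkConfig G starFour a)
    (hdeg : ∀ w, 4 ≤ (nbrs G w univ).card) {S S' S'' D : Finset (Fin 4)}
    (hS : LeafTypes S S' S'' D) (hSS' : S ≠ S') (hSS'' : S ≠ S'')
    (hD : (cls G a D).card = 0) (hpos : 0 < (cls G a S).card) :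
    (cls G a S').card + (cls G a S'').card + 2 * (cls G a S).card ≤
      (between G (cls G a S) (cls G a S')).card + (between G (cls G a S) (cls G a S'')).card +
      (between G (cls G a S') (cls G a S'')).card + 2 := by
  classical
  obtain ⟨x, hx⟩ := Finset.card_pos.1 hpos
  have h1 : (cls G a S').card + (cls G a S'').card ≤
      (between G (cls G a S') (cls G a S'')).card + (nbrs G x (cls G a S')).card +
        (nbrs G x (cls G a S'')).card := by
    refine card_add_card_le_between ?_ ?_
    · intro y hy hxy
      exact starFour_common hc hS.2.2.2.2.2.1 hSS' hS.2.2.2.2.2.2.2.1 hx hy hxy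
    · intro z hz hxz
      exact starFour_common hc hS.2.2.2.2.2.2.1 hSS'' hS.2.2.2.2.2.2.2.2 hx hz hxz
  have h2 : (nbrs G x (cls G a S')).card + (nbrs G x (cls G a S'')).card +
      2 * ((cls G a S).erase x).card ≤ (between G (cls G a S) (cls G a S')).card +
      (between G (cls G a S) (cls G a S'')).card := by
    rw [card_between_eq_sum, card_between_eq_sum, ← Finset.sum_add_distrib,
      ← Finset.add_sum_erase _ _ hx, mul_comm, ← smul_eq_mul]
    refine Nat.add_le_add le_rfl (Finset.card_nsmul_le_sum _ _ _ fun x' hx' => ?_)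
    have := starFour_degree hc hdeg hS (mem_of_mem_erase hx')
    omega
  rw [Finset.card_erase_of_mem hx] at h2
  omega

theorem starFour_complete (hc : LinkConfig G starFour a) {S S' S'' D : Finset (Fin 4)}
    (hS : LeafTypes S S' S'' D) (hSS' : S ≠ S') (h : (cls G a S'').card = 0) :
    (between G (cls G a S) (cls G a S')).card = (cls G a S).card * (cls G a S').card := by
  refine card_between_complete fun x hx y hy => ?_
  by_contra hxy
  obtain ⟨z, hz, -⟩ := starFour_common hc hS.2.2.2.2.2.1 hSS' hS.2.2.2.2.2.2.2.1 hx hy hxy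
  rw [Finset.card_eq_zero] at h
  simp [h] at hz

theorem LinkConfig.exists_nbr_of_card_eq_zero {H : Fin 4 → Fin 4 → Bool} (hc : LinkConfig G H a)
    {L : Finset (Finset (Fin 4))} (hL : ∀ w ∉ Set.range a, typ G a w ∈ L)
    {S M M' : Finset (Fin 4)} {i : Fin 4} (h : ForcesNbr H L S i {M, M'})
    (hM' : (cls G a M').card = 0) : ∀ u ∈ cls G a S, ∃ z ∈ cls G a M, G.Adj u z := by
  intro u hu
  obtain ⟨T, hT, z, hz, huz⟩ := hc.exists_nbr_cls hL h hu
  rw [mem_insert, mem_singleton] at hT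
  rcases hT with rfl | rfl
  · exact ⟨z, hz, huz⟩
  · rw [Finset.card_eq_zero] at hM'
    simp [hM'] at hz

/-- Adjacent vertices `y`, `z` of types `S'`, `S''` each need a neighbour of type `S`; if it were
the same vertex, there would be an outer triangle. -/
theorem starFour_two_le_card (hc : LinkConfig G starFour a) {S S' S'' D' D'' : Finset (Fin 4)}
    {i i'' : Fin 4} (hi' : ForcesNbr starFour starFourTypes S' i'' {S'', D'})
    (hi : ForcesNbr starFour starFourTypes S' i {S, D'})
    (hi'' : ForcesNbr starFour starFourTypes S'' i {S, D''})
    (h3 : 3 ∈ S ∧ 3 ∈ S' ∧ 3 ∈ S'')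
    (hD' : (cls G a D').card = 0) (hD'' : (cls G a D'').card = 0)
    (hpos : 0 < (cls G a S').card) : 2 ≤ (cls G a S).card := by
  have hL := typ_mem_starFourTypes hc
  obtain ⟨y, hy⟩ := Finset.card_pos.1 hpos
  obtain ⟨x, hx, hyx⟩ := hc.exists_nbr_of_card_eq_zero hL hi hD' y hy
  obtain ⟨z, hz, hyz⟩ := hc.exists_nbr_of_card_eq_zero hL hi' hD' y hy
  obtain ⟨x', hx', hzx⟩ := hc.exists_nbr_of_card_eq_zero hL hi'' hD'' z hz
  by_contra hlt
  have hxx : x = x' := Finset.card_le_one.1 (by omega) x hx x' hx'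
  subst hxx
  rw [mem_cls] at hx hy hz
  refine starFour_no_triangle hc (x := x) (y := y) (z := z) ?_ ?_ ?_ hyx.symm hzx.symm hyz
  · rw [hx.2]; exact h3.1
  · rw [hy.2]; exact h3.2.1
  · rw [hz.2]; exact h3.2.2

theorem starFour_tripartite (hc : LinkConfig G starFour a) (h0 : (cls G a {1, 2, 3}).card = 0)
    (h1 : (cls G a {0, 2, 3}).card = 0) (h2 : (cls G a {0, 1, 3}).card = 0) :
    Tripartite G (cls G a {0, 3}) (cls G a {1, 3}) (cls G a {2, 3}) := by
  have hL := typ_mem_starFourTypes hc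
  have t3 : ∀ {S : Finset (Fin 4)} {w : V}, w ∈ cls G a S → 3 ∈ S → 3 ∈ typ G a w := by
    intro S w hw hS
    rw [(mem_cls.1 hw).2]; exact hS
  refine
    { free := fun x hx y hy z hz => starFour_no_triangle hc (t3 hx (by decide))
        (t3 hy (by decide)) (t3 hz (by decide))
      xy := hc.exists_nbr_of_card_eq_zero hL (i := 1) (M' := {1, 2, 3}) (by decide +kernel) h0
      xz := hc.exists_nbr_of_card_eq_zero hL (i := 2) (M' := {1, 2, 3}) (by decide +kernel) h0
      yx := hc.exists_nbr_of_card_eq_zero hL (i := 0) (M' := {0, 2, 3}) (by decide +kernel) h1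
      yz := hc.exists_nbr_of_card_eq_zero hL (i := 2) (M' := {0, 2, 3}) (by decide +kernel) h1
      zx := hc.exists_nbr_of_card_eq_zero hL (i := 0) (M' := {0, 1, 3}) (by decide +kernel) h2
      zy := hc.exists_nbr_of_card_eq_zero hL (i := 1) (M' := {0, 1, 3}) (by decide +kernel) h2
      commonX := fun y hy z hz => starFour_common hc (by decide +kernel) (by decide)
        (by decide +kernel) hy hz
      commonY := fun x hx z hz => starFour_common hc (by decide +kernel) (by decide)
        (by decide +kernel) hx hz
      commonZ := fun x hx y hy => starFour_common hc (by decide +kernel) (by decide)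
        (by decide +kernel) hx hy }

theorem starFour_counts (hc : LinkConfig G starFour a) (hdeg : ∀ w, 4 ≤ (nbrs G w univ).card) :
    StarCounts (Fintype.card V) (triangles G).card (cls G a univ).card
      (cls G a {0, 3}).card (cls G a {1, 3}).card (cls G a {2, 3}).card
      (cls G a {1, 2, 3}).card (cls G a {0, 2, 3}).card (cls G a {0, 1, 3}).card
      (between G (cls G a {0, 3}) (cls G a {1, 3})).card
      (between G (cls G a {0, 3}) (cls G a {2, 3})).card
      (between G (cls G a {1, 3}) (cls G a {2, 3})).card := by
  have hL := typ_mem_starFourTypes hc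
  have l0 : LeafTypes {0, 3} {1, 3} {2, 3} {1, 2, 3} := by decide +kernel
  have l1 : LeafTypes {1, 3} {0, 3} {2, 3} {0, 2, 3} := by decide +kernel
  have l2 : LeafTypes {2, 3} {0, 3} {1, 3} {0, 1, 3} := by decide +kernel
  have k01 := card_between_comm (G := G) (cls G a {0, 3}) (cls G a {1, 3})
  have k02 := card_between_comm (G := G) (cls G a {0, 3}) (cls G a {2, 3})
  have k12 := card_between_comm (G := G) (cls G a {1, 3}) (cls G a {2, 3})
  have single : ∀ {S M : Finset (Fin 4)} {i : Fin 4},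
      ForcesNbr starFour starFourTypes S i {M} → 0 < (cls G a S).card →
      0 < (cls G a M).card := by
    intro S M i h hS
    obtain ⟨u, hu⟩ := Finset.card_pos.1 hS
    obtain ⟨T, hT, z, hz, -⟩ := hc.exists_nbr_cls hL h hu
    rw [mem_singleton] at hT
    subst hT
    exact Finset.card_pos.2 ⟨z, hz⟩
  refine
    { card := ?_
      pos := hc.cls_univ_pos
      le := ?_
      n0_pos := single (i := 0) (by decide +kernel)
      n1_pos := single (i := 1) (by decide +kernel)
      n2_pos := single (i := 2) (by decide +kernel)
      z01 := hc.card_cls_le_of_forcesNbr hL (i := 1) (by decide +kernel)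
      z02 := hc.card_cls_le_of_forcesNbr hL (i := 2) (by decide +kernel)
      z10 := by rw [k01]; exact hc.card_cls_le_of_forcesNbr hL (i := 0) (by decide +kernel)
      z12 := hc.card_cls_le_of_forcesNbr hL (i := 2) (by decide +kernel)
      z20 := by rw [k02]; exact hc.card_cls_le_of_forcesNbr hL (i := 0) (by decide +kernel)
      z21 := by rw [k12]; exact hc.card_cls_le_of_forcesNbr hL (i := 1) (by decide +kernel)
      h0 := starFour_card_le_between hc hdeg l0
      h1 := by rw [k01]; exact starFour_card_le_between hc hdeg l1
      h2 := by rw [k02, k12]; exact starFour_card_le_between hc hdeg l2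
      s0 := starFour_card_add_le_between hc hdeg l0 (by decide) (by decide)
      s1 := fun h h' => by
        have := starFour_card_add_le_between hc hdeg l1 (by decide) (by decide) h h'
        omega
      s2 := fun h h' => by
        have := starFour_card_add_le_between hc hdeg l2 (by decide) (by decide) h h'
        omega
      c01 := starFour_complete hc l0 (by decide)
      c02 := starFour_complete hc (D := {1, 2, 3}) (by decide +kernel) (by decide)
      c12 := starFour_complete hc (D := {0, 2, 3}) (by decide +kernel) (by decide)
      u01 := card_pos_of_card_between_pos
      u02 := card_pos_of_card_between_pos
      u12 := card_pos_of_card_between_pos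
      two0 := fun _ h1 h2 => starFour_two_le_card hc (S := {0, 3}) (S' := {1, 3}) (S'' := {2, 3})
        (i := 0) (i'' := 2) (by decide +kernel) (by decide +kernel) (by decide +kernel)
        (by decide) h1 h2
      two1 := fun _ h0 h2 => starFour_two_le_card hc (S := {1, 3}) (S' := {0, 3}) (S'' := {2, 3})
        (i := 1) (i'' := 2) (by decide +kernel) (by decide +kernel) (by decide +kernel)
        (by decide) h0 h2
      two2 := fun _ h0 h1 => starFour_two_le_card hc (S := {2, 3}) (S' := {0, 3}) (S'' := {1, 3})
        (i := 2) (i'' := 1) (by decide +kernel) (by decide +kernel) (by decide +kernel)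
        (by decide) h0 h1
      gen := fun h0 h1 h2 => (starFour_tripartite hc h0 h1 h2).le_or_le }
  · rw [hc.card_eq_sum_types hL, starFourTypes]
    repeat rw [Finset.sum_insert (by decide)]
    rw [Finset.sum_singleton]
    ring
  · have h := sum_le_card_triangles hc
      {({0, 3}, {1, 3}), ({0, 3}, {2, 3}), ({1, 3}, {2, 3}), ({0, 3}, {1, 2, 3}),
        ({1, 3}, {0, 2, 3}), ({2, 3}, {0, 1, 3})} (by decide +kernel)
    rw [LinkConfig.sum_types hL, starFourTypes] at h
    repeat rw [Finset.sum_insert (by decide +kernel)] at h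
    rw [Finset.sum_singleton, Finset.sum_singleton,
      hc.card_between_cls hL (S := {0, 3}) (S' := {1, 2, 3}) (by decide) (by decide +kernel),
      hc.card_between_cls hL (S := {1, 3}) (S' := {0, 2, 3}) (by decide) (by decide +kernel),
      hc.card_between_cls hL (S := {2, 3}) (S' := {0, 1, 3}) (by decide) (by decide +kernel),
      show (edgePairs starFour {0, 3}).card = 1 by decide +kernel,
      show (edgePairs starFour {1, 3}).card = 1 by decide +kernel,
      show (edgePairs starFour {2, 3}).card = 1 by decide +kernel,
      show (edgePairs starFour {1, 2, 3}).card = 2 by decide +kernel,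
      show (edgePairs starFour {0, 2, 3}).card = 2 by decide +kernel,
      show (edgePairs starFour {0, 1, 3}).card = 2 by decide +kernel,
      show (edgePairs starFour univ).card = 3 by decide +kernel] at h
    simp only [
      show (({0, 3} : Finset (Fin 4)) ∩ {1, 3}).card = 1 by decide,
      show (({0, 3} : Finset (Fin 4)) ∩ {2, 3}).card = 1 by decide,
      show (({1, 3} : Finset (Fin 4)) ∩ {2, 3}).card = 1 by decide,
      show (({0, 3} : Finset (Fin 4)) ∩ {1, 2, 3}).card = 1 by decide,
      show (({1, 3} : Finset (Fin 4)) ∩ {0, 2, 3}).card = 1 by decide,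
      show (({2, 3} : Finset (Fin 4)) ∩ {0, 1, 3}).card = 1 by decide] at h
    refine le_trans (le_of_eq ?_) ((Nat.le_add_right _ _).trans h)
    ring

theorem starFour_bound (hc : LinkConfig G starFour a) (hdeg : ∀ w, 4 ≤ (nbrs G w univ).card)
    (hn : 14 ≤ Fintype.card V) :
    2 * Fintype.card V - 4 ≤ (triangles G).card ∧
    (15 ≤ Fintype.card V → 2 * Fintype.card V - 4 < (triangles G).card) :=
  (starFour_counts hc hdeg).bound hn

end Star

/-! ### Invariance under isomorphism. -/

section Iso

variable {V W : Type*} {G : SimpleGraph V} {G' : SimpleGraph W}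

theorem IsGraphSaturated.of_iso (f : G ≃g G')
    (h : IsGraphSaturated (SimpleGraph.completeGraph (Fin 4)) G') :
    IsGraphSaturated (SimpleGraph.completeGraph (Fin 4)) G := by
  rw [isGraphSaturated_four_iff, cliqueFree_four_iff] at h ⊢
  have m : ∀ {x y}, G.Adj x y → G'.Adj (f x) (f y) := fun hxy => f.map_adj_iff.2 hxy
  have m' : ∀ {x p}, G'.Adj (f x) p → G.Adj x (f.symm p) := fun {x p} hxp => by
    rw [← f.map_adj_iff, RelIso.apply_symm_apply]
    exact hxp
  refine ⟨fun x y z w h1 h2 h3 h4 h5 h6 =>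
    h.1 _ _ _ _ (m h1) (m h2) (m h3) (m h4) (m h5) (m h6), fun x y hxy hadj => ?_⟩
  obtain ⟨p, q, h1, h2, h3, h4, h5⟩ := h.2 (f x) (f y) (fun e => hxy (f.injective e))
    (fun e => hadj (f.map_adj_iff.1 e))
  refine ⟨f.symm p, f.symm q, ?_, m' h2, m' h3, m' h4, m' h5⟩
  rwa [← f.map_adj_iff, RelIso.apply_symm_apply, RelIso.apply_symm_apply]

theorem card_triangles_le_of_iso [Fintype V] [Fintype W] (f : G ≃g G') :
    (triangles G).card ≤ (triangles G').card := by
  classical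
  refine Finset.card_le_card_of_injOn (fun s => s.image f) ?_ ?_
  · intro s hs
    have hs : G.IsNClique 3 s := mem_triangles.1 hs
    have : G'.IsNClique 3 (s.image f) := by
      rw [SimpleGraph.is3Clique_iff] at hs ⊢
      obtain ⟨x, y, z, h1, h2, h3, rfl⟩ := hs
      exact ⟨f x, f y, f z, f.map_adj_iff.2 h1, f.map_adj_iff.2 h2, f.map_adj_iff.2 h3,
        by simp [Finset.image_insert]⟩
    exact mem_triangles.2 this
  · intro s _ s' _ h
    exact Finset.image_injective f.injective h

end Iso

/-! ### The graph H₄(n): saturation, minimum degree and triangles. -/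

section GraphH

/-- The vertices of `H_4(n)`, with the vertices of the independent set `X` identified to `none`. -/
abbrev HClass := Option (Fin 4 ⊕ Fin 4)

/-- Adjacency of `H_4(n)` between classes. -/
def classAdj : HClass → HClass → Bool
  | some (.inl i), some (.inl j) => twoEdges i j
  | some (.inr i), some (.inr j) => decide ((i < 2 ∧ 2 ≤ j) ∨ (2 ≤ i ∧ j < 2))
  | some (.inl i), some (.inr j) => decide (i ≠ j)
  | some (.inr i), some (.inl j) => decide (i ≠ j)
  | some (.inl _), none => true
  | none, some (.inl _) => true
  | _, _ => false

theorem graphA_adj_iff (i j : Fin 4) : graphA.Adj i j ↔ twoEdges i j = true := by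
  fin_cases i <;> fin_cases j <;> simp [graphA, twoEdges]

theorem graphB_adj_iff (i j : Fin 4) :
    graphB.Adj i j ↔ (i < 2 ∧ 2 ≤ j) ∨ (2 ≤ i ∧ j < 2) := by
  fin_cases i <;> fin_cases j <;> simp [graphB]

/-- The class of a vertex of `H_4(n)`. -/
def hClass {n : ℕ} : HVertex 4 n → HClass
  | .a i => some (.inl i)
  | .b i => some (.inr i)
  | .x _ => none
  | .y _ => none

theorem graphH_adj_iff {n : ℕ} (u v : HVertex 4 n) :
    (graphH 4 n).Adj u v ↔ classAdj (hClass u) (hClass v) = true := by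
  change HAdj 4 n u v ↔ _
  rcases u with i | i | i | i
  all_goals first | exact i.elim0 | skip
  all_goals rcases v with j | j | j | j
  all_goals first | exact j.elim0 | skip
  all_goals simp [HAdj, classAdj, hClass, graphA_adj_iff, graphB_adj_iff] <;>
    exact not_congr eq_comm

theorem hClass_surjective {n : ℕ} (hn : 9 ≤ n) : Function.Surjective (hClass (n := n)) := by
  intro c
  rcases c with _ | i | i
  · exact ⟨.x ⟨0, by omega⟩, rfl⟩
  · exact ⟨.a i, rfl⟩
  · exact ⟨.b i, rfl⟩

theorem hClass_eq {n : ℕ} {u v : HVertex 4 n} (h : hClass u = hClass v) (huv : u ≠ v) :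
    hClass u = none := by
  rcases u with i | i | i | i <;> rcases v with j | j | j | j <;> simp_all [hClass]

set_option maxRecDepth 100000 in
theorem classAdj_free : ∀ x y, classAdj x y = true → ∀ z, classAdj x z = true →
    classAdj y z = true → ∀ w, classAdj x w = true → classAdj y w = true →
    classAdj z w = true → False := by
  decide +kernel

-- The case x = y is needed for the class `none` alone, the only one that can contain two vertices
-- of H₄(n).
set_option maxRecDepth 100000 in
theorem classAdj_sat : ∀ x y, (x = y → x = none) → classAdj x y = false →
    ∃ p, classAdj x p = true ∧ classAdj y p = true ∧ ∃ q, classAdj p q = true ∧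
      classAdj x q = true ∧ classAdj y q = true := by
  decide +kernel

theorem graphH_saturated {n : ℕ} (hn : 9 ≤ n) :
    IsGraphSaturated (SimpleGraph.completeGraph (Fin 4)) (graphH 4 n) := by
  rw [isGraphSaturated_four_iff, cliqueFree_four_iff]
  simp only [graphH_adj_iff]
  refine ⟨fun x y z w h1 h2 h3 h4 h5 h6 => classAdj_free _ _ h1 _ h2 h4 _ h3 h5 h6,
    fun x y hxy h => ?_⟩
  obtain ⟨p, h1, h2, q, h3, h4, h5⟩ := classAdj_sat (hClass x) (hClass y)
    (fun e => hClass_eq e hxy) (by simpa using h)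
  obtain ⟨p, rfl⟩ := hClass_surjective hn p
  obtain ⟨q, rfl⟩ := hClass_surjective hn q
  exact ⟨p, q, h3, h1, h4, h2, h5⟩

/-- The vertices of `H_t(n)` as a sum of finite types. -/
def hVertexEquiv (t n : ℕ) :
    HVertex t n ≃ (Fin 4 ⊕ Fin 4) ⊕ (Fin (n - t - 4) ⊕ Fin (t - 4)) where
  toFun
    | .a i => .inl (.inl i)
    | .b i => .inl (.inr i)
    | .x i => .inr (.inl i)
    | .y i => .inr (.inr i)
  invFun
    | .inl (.inl i) => .a i
    | .inl (.inr i) => .b i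
    | .inr (.inl i) => .x i
    | .inr (.inr i) => .y i
  left_inv u := by cases u <;> rfl
  right_inv u := by rcases u with (i | i) | (i | i) <;> rfl

instance hVertexFintype (t n : ℕ) : Fintype (HVertex t n) :=
  Fintype.ofEquiv _ (hVertexEquiv t n).symm

theorem card_hVertex {n : ℕ} (hn : 8 ≤ n) : Fintype.card (HVertex 4 n) = n := by
  rw [Fintype.card_congr (hVertexEquiv 4 n)]
  simp
  omega

theorem four_le_card_classAdj : ∀ x, 4 ≤ (univ.filter fun y => classAdj x y = true).card := by
  decide +kernel

theorem graphH_minDegree {n : ℕ} (hn : 9 ≤ n) [DecidableRel (graphH 4 n).Adj] :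
    (graphH 4 n).minDegree = 4 := by
  classical
  have : Nonempty (HVertex 4 n) := ⟨.a 0⟩
  apply le_antisymm
  · refine ((graphH 4 n).minDegree_le_degree (.x ⟨0, by omega⟩)).trans ?_
    rw [← SimpleGraph.card_neighborFinset_eq_degree]
    have : (graphH 4 n).neighborFinset (.x ⟨0, by omega⟩) ⊆
        (univ : Finset (Fin 4)).image HVertex.a := by
      intro u hu
      rw [SimpleGraph.mem_neighborFinset, graphH_adj_iff] at hu
      rcases u with i | i | i | i <;> simp [hClass, classAdj] at hu ⊢
    exact (Finset.card_le_card this).trans (Finset.card_image_le.trans (by simp))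
  · refine (graphH 4 n).le_minDegree_of_forall_le_degree 4 fun u => ?_
    rw [← SimpleGraph.card_neighborFinset_eq_degree]
    refine (four_le_card_classAdj (hClass u)).trans ?_
    refine (Finset.card_le_card ?_).trans
      (Finset.card_image_le (s := (graphH 4 n).neighborFinset u) (f := hClass))
    intro c hc
    obtain ⟨v, rfl⟩ := hClass_surjective hn c
    rw [mem_image]
    exact ⟨v, by simpa [graphH_adj_iff] using hc, rfl⟩

/-- The triangles of `H_4(n)` that avoid the set `X`. -/
def coreTriangles : Finset (Finset (Fin 4 ⊕ Fin 4)) :=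
  univ.filter fun t => t.card = 3 ∧
    ∀ u ∈ t, ∀ v ∈ t, u ≠ v → classAdj (some u) (some v) = true

/-- Each of the two edges in A has two common neighbours in B, each of the four edges in B has two
in A, and neither part contains a triangle. -/
theorem card_coreTriangles : coreTriangles.card = 12 := by
  decide +kernel

/-- The vertices of `H_4(n)` outside the set `X`. -/
def coreVertex (n : ℕ) : Fin 4 ⊕ Fin 4 → HVertex 4 n
  | .inl i => .a i
  | .inr i => .b i

theorem hClass_coreVertex (n : ℕ) (u : Fin 4 ⊕ Fin 4) : hClass (coreVertex n u) = some u := by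
  cases u <;> rfl

theorem eq_x_or_coreVertex {n : ℕ} (u : HVertex 4 n) :
    (∃ j, u = .x j) ∨ ∃ c, u = coreVertex n c := by
  rcases u with i | i | i | i
  · exact Or.inr ⟨.inl i, rfl⟩
  · exact Or.inr ⟨.inr i, rfl⟩
  · exact Or.inl ⟨i, rfl⟩
  · exact i.elim0

theorem twoEdges_cases : ∀ i j : Fin 4, twoEdges i j = true →
    (i = 0 ∧ j = 1) ∨ (i = 1 ∧ j = 0) ∨ (i = 2 ∧ j = 3) ∨ (i = 3 ∧ j = 2) := by
  decide +kernel

/-- A vertex of X lies in two triangles, one for each edge in A, and 2(n - 8) + 12 = 2n - 4. Only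
the upper bound is needed, as the lower one comes from the general theorem. -/
theorem card_triangles_graphH_le {n : ℕ} (hn : 9 ≤ n) :
    (triangles (graphH 4 n)).card ≤ 2 * n - 4 := by
  classical
  let f : Fin (n - 4 - 4) × Bool → Finset (HVertex 4 n) := fun p =>
    if p.2 then {.x p.1, .a 0, .a 1} else {.x p.1, .a 2, .a 3}
  have hx : ∀ (j : Fin (n - 4 - 4)) (v w : HVertex 4 n), (graphH 4 n).Adj (.x j) v →
      (graphH 4 n).Adj (.x j) w → (graphH 4 n).Adj v w →
      ({.x j, v, w} : Finset (HVertex 4 n)) ∈ univ.image f := by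
    intro j v w h1 h2 h3
    rw [graphH_adj_iff] at h1 h2 h3
    rcases v with i | i | i | i <;> simp [hClass, classAdj] at h1
    rcases w with k | k | k | k <;> simp [hClass, classAdj] at h2
    simp only [hClass, classAdj] at h3
    rw [mem_image]
    rcases twoEdges_cases i k h3 with ⟨rfl, rfl⟩ | ⟨rfl, rfl⟩ | ⟨rfl, rfl⟩ | ⟨rfl, rfl⟩
    · exact ⟨(j, true), mem_univ _, rfl⟩
    · exact ⟨(j, true), mem_univ _, by simp [f, Finset.pair_comm]⟩
    · exact ⟨(j, false), mem_univ _, rfl⟩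
    · exact ⟨(j, false), mem_univ _, by simp [f, Finset.pair_comm]⟩
  have hsub : triangles (graphH 4 n) ⊆
      univ.image f ∪ coreTriangles.image (fun t => t.image (coreVertex n)) := by
    intro s hs
    rw [mem_triangles, SimpleGraph.is3Clique_iff] at hs
    obtain ⟨u, v, w, h1, h2, h3, rfl⟩ := hs
    rw [mem_union]
    rcases eq_x_or_coreVertex u with ⟨j, rfl⟩ | ⟨u, rfl⟩
    · exact Or.inl (hx j v w h1 h2 h3)
    rcases eq_x_or_coreVertex v with ⟨j, rfl⟩ | ⟨v, rfl⟩
    · left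
      rw [Finset.insert_comm]
      exact hx j _ w h1.symm h3 h2
    rcases eq_x_or_coreVertex w with ⟨j, rfl⟩ | ⟨w, rfl⟩
    · left
      rw [Finset.pair_comm, Finset.insert_comm]
      exact hx j _ _ h2.symm h3.symm h1
    · right
      have ne1 : u ≠ v := fun e => h1.ne (by rw [e])
      have ne2 : u ≠ w := fun e => h2.ne (by rw [e])
      have ne3 : v ≠ w := fun e => h3.ne (by rw [e])
      have g1 := h1.symm
      have g2 := h2.symm
      have g3 := h3.symm
      rw [graphH_adj_iff, hClass_coreVertex, hClass_coreVertex] at h1 h2 h3 g1 g2 g3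
      rw [mem_image]
      refine ⟨{u, v, w}, ?_, by simp [Finset.image_insert]⟩
      simp only [coreTriangles, mem_filter, mem_univ, true_and]
      refine ⟨Finset.card_eq_three.2 ⟨u, v, w, ne1, ne2, ne3, rfl⟩, ?_⟩
      intro p hp q hq hpq
      simp only [mem_insert, mem_singleton] at hp hq
      rcases hp with rfl | rfl | rfl <;> rcases hq with rfl | rfl | rfl <;>
        first | exact absurd rfl hpq | assumption
  have c1 := Finset.card_le_card hsub
  have c2 := Finset.card_union_le (univ.image f)
    (coreTriangles.image (fun t => t.image (coreVertex n)))
  have c3 : (univ.image f).card ≤ (n - 4 - 4) * 2 :=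
    Finset.card_image_le.trans (by simp)
  have c4 : (coreTriangles.image (fun t => t.image (coreVertex n))).card ≤ 12 :=
    Finset.card_image_le.trans card_coreTriangles.le
  omega

end GraphH

/-! ### Recovering H₄(n) from the equality case. -/

section Uniqueness

variable {V : Type*} [Fintype V] {G : SimpleGraph V} {a : Fin 4 → V}

/-- The link is A, the single vertex whose type misses `i` is `b i`, and the vertices of full type,
the apex among them, are X. Types sharing an edge of the link forbid adjacency; the remaining pairs
inside B are joined by `twoEdges_adj`. -/
theorem LinkConfig.nonempty_iso_graphH (hc : LinkConfig G twoEdges a)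
    (h : ∀ i : Fin 4, (cls G a (univ.erase i)).card = 1) {n : ℕ} (hn : Fintype.card V = n) :
    Nonempty (G ≃g graphH 4 n) := by
  classical
  have hsum := twoEdges_card hc
  have e3 : (univ : Finset (Fin 4)).erase 3 = {0, 1, 2} := by decide
  have e2 : (univ : Finset (Fin 4)).erase 2 = {0, 1, 3} := by decide
  have e1 : (univ : Finset (Fin 4)).erase 1 = {0, 2, 3} := by decide
  have e0 : (univ : Finset (Fin 4)).erase 0 = {1, 2, 3} := by decide
  rw [← e0, ← e1, ← e2, ← e3, h, h, h, h] at hsum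
  choose b hb using fun i => Finset.card_eq_one.1 (h i)
  have hb' : ∀ i, b i ∈ cls G a (univ.erase i) := fun i => by rw [hb i]; simp
  have hbr : ∀ i, b i ∉ Set.range a := fun i => (mem_cls.1 (hb' i)).1
  have hbt : ∀ i, typ G a (b i) = univ.erase i := fun i => (mem_cls.1 (hb' i)).2
  -- The link and the four singleton classes use eight vertices.
  have e : Fin (n - 4 - 4) ≃ cls G a univ :=
    (Fintype.equivFinOfCardEq (by rw [Fintype.card_coe]; omega)).symm
  have her : ∀ j, (e j : V) ∉ Set.range a := fun j => (mem_cls.1 (e j).2).1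
  have het : ∀ j, typ G a (e j) = univ := fun j => (mem_cls.1 (e j).2).2
  let f : HVertex 4 n → V := fun u => match u with
    | .a i => a i
    | .b i => b i
    | .x j => e j
    | .y j => j.elim0
  have hbb : ∀ i j, G.Adj (b i) (b j) ↔ (i < 2 ∧ 2 ≤ j) ∨ (2 ≤ i ∧ j < 2) := by
    have k1 : ∀ i j : Fin 4, ¬ ((i < 2 ∧ 2 ≤ j) ∨ (2 ≤ i ∧ j < 2)) →
        ¬ Compat twoEdges (univ.erase i) (univ.erase j) := by decide +kernel
    have k2 : ∀ i : Fin 4, i < 2 → (univ : Finset (Fin 4)).erase i = {0, 2, 3} ∨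
        (univ : Finset (Fin 4)).erase i = {1, 2, 3} := by decide +kernel
    have k3 : ∀ i : Fin 4, 2 ≤ i → (univ : Finset (Fin 4)).erase i = {0, 1, 2} ∨
        (univ : Finset (Fin 4)).erase i = {0, 1, 3} := by decide +kernel
    intro i j
    constructor
    · intro hij
      by_contra hcon
      have := hc.compat hij
      rw [hbt, hbt] at this
      exact k1 i j hcon this
    · rintro (⟨hi, hj⟩ | ⟨hi, hj⟩)
      · exact (twoEdges_adj hc (k3 j hj) (k2 i hi) (hb' j) (hb' i)).symm
      · exact twoEdges_adj hc (k3 i hi) (k2 j hj) (hb' i) (hb' j)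
  have hu : ∀ S : Finset (Fin 4), SpansEdge twoEdges S → ∀ u w, typ G a u = univ →
      typ G a w = S → ¬ G.Adj u w := by
    intro S hS u w hu hw huw
    have := hc.compat huw
    rw [hu, hw, Compat, univ_inter] at this
    exact this hS
  have hs : ∀ i : Fin 4, SpansEdge twoEdges (univ.erase i) := by decide +kernel
  have hba : ∀ i r, G.Adj (b i) (a r) ↔ r ≠ i := fun i r => by
    rw [← mem_typ, hbt]; simp
  have hea : ∀ j r, G.Adj (e j) (a r) := fun j r => by
    rw [← mem_typ, het]; simp
  have hf : Function.Bijective f := by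
    rw [Fintype.bijective_iff_injective_and_card]
    refine ⟨?_, by rw [card_hVertex (by omega), hn]⟩
    intro u v huv
    rcases u with i | i | i | i
    all_goals first | exact i.elim0 | skip
    all_goals rcases v with j | j | j | j
    all_goals first | exact j.elim0 | skip
    all_goals simp only [f] at huv
    · rw [hc.inj huv]
    · exact (hbr j ⟨i, huv⟩).elim
    · exact (her j ⟨i, huv⟩).elim
    · exact (hbr i ⟨j, huv.symm⟩).elim
    · have h1 := hbt i
      rw [huv, hbt j] at h1
      have : j ∉ (univ : Finset (Fin 4)).erase i := by rw [← h1]; simp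
      rw [show j = i by simpa using this]
    · have h1 := hbt i
      rw [huv, het j] at h1
      have : i ∉ (univ : Finset (Fin 4)) := by rw [h1]; simp
      simp at this
    · exact (her i ⟨j, huv.symm⟩).elim
    · have h1 := hbt j
      rw [← huv, het i] at h1
      have : j ∉ (univ : Finset (Fin 4)) := by rw [h1]; simp
      simp at this
    · rw [e.injective (Subtype.ext huv)]
  have hadj : ∀ u v, G.Adj (f u) (f v) ↔ (graphH 4 n).Adj u v := by
    intro u v
    rw [graphH_adj_iff]
    rcases u with i | i | i | i
    all_goals first | exact i.elim0 | skip
    all_goals rcases v with j | j | j | j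
    all_goals first | exact j.elim0 | skip
    all_goals simp only [f, hClass, classAdj]
    · exact hc.adj i j
    · rw [G.adj_comm, hba]; simp
    · rw [G.adj_comm]; simp [hea]
    · rw [hba, decide_eq_true_iff]; exact ne_comm
    · rw [hbb]; simp
    · rw [G.adj_comm]
      simp [hu _ (hs i) _ _ (het j) (hbt i)]
    · simp [hea]
    · simp [hu _ (hs j) _ _ (het i) (hbt j)]
    · simp [hu univ (by decide) _ _ (het i) (het j)]
  exact ⟨(⟨Equiv.ofBijective f hf, fun {u v} => hadj u v⟩ : graphH 4 n ≃g G).symm⟩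

end Uniqueness

/-! ### Assembling the cases. -/

section Main

variable {V : Type*} [Fintype V]

theorem triangle_bound (G : SimpleGraph V) [DecidableRel G.Adj] {n : ℕ} (hn : 14 ≤ n)
    (hV : Fintype.card V = n)
    (hG : IsGraphSaturated (SimpleGraph.completeGraph (Fin 4)) G) (hd : G.minDegree = 4) :
    2 * n - 4 ≤ (triangles G).card ∧
      (15 ≤ n → (triangles G).card = 2 * n - 4 → Nonempty (G ≃g graphH 4 n)) := by
  classical
  subst hV
  have hdeg : ∀ w, 4 ≤ (nbrs G w univ).card := by
    intro w
    have h := G.minDegree_le_degree w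
    rw [hd, ← SimpleGraph.card_neighborFinset_eq_degree] at h
    refine h.trans (Finset.card_le_card fun v hv => ?_)
    rw [SimpleGraph.mem_neighborFinset] at hv
    exact mem_nbrs.2 ⟨mem_univ _, hv⟩
  obtain ⟨b, hb | hb | hb | hb⟩ := exists_linkConfig (by omega) hG hd
  · obtain ⟨h1, h2⟩ := twoEdges_bound hb
    refine ⟨h1, fun _ h => hb.nonempty_iso_graphH (fun i => ?_) rfl⟩
    obtain ⟨g1, g2, g3, g4⟩ := h2 h
    fin_cases i
    · exact g4
    · exact g3
    · exact g2
    · exact g1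
  · have := pathFour_bound hb (by omega)
    exact ⟨this.le, fun _ h => (this.ne' h).elim⟩
  · have := cycleFour_bound hb hn
    exact ⟨this.le, fun _ h => (this.ne' h).elim⟩
  · obtain ⟨h1, h2⟩ := starFour_bound hb hdeg hn
    exact ⟨h1, fun h15 h => ((h2 h15).ne' h).elim⟩

end Main

theorem theorem1 (n : ℕ) (hn : 14 ≤ n) :
    (∀ (V : Type*) [Fintype V] (G : SimpleGraph V) [DecidableRel G.Adj],
      Fintype.card V = n →
      IsGraphSaturated (SimpleGraph.completeGraph (Fin 4)) G →
      G.minDegree = 4 →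
        2 * n - 4 ≤ G.copyCount (SimpleGraph.completeGraph (Fin 3)) ∧
        (Nonempty (G ≃g graphH 4 n) →
          G.copyCount (SimpleGraph.completeGraph (Fin 3)) = 2 * n - 4) ∧
        (15 ≤ n → G.copyCount (SimpleGraph.completeGraph (Fin 3)) = 2 * n - 4 →
          Nonempty (G ≃g graphH 4 n))) ∧
    satMinDeg 4 n (SimpleGraph.completeGraph (Fin 3)) (SimpleGraph.completeGraph (Fin 4)) =
      2 * n - 4 := by
  classical
  constructor
  · intro V _ G _ hV hG hd
    rw [copyCount_three_eq]
    obtain ⟨h1, h2⟩ := triangle_bound G hn hV hG hd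
    refine ⟨h1, ?_, h2⟩
    rintro ⟨f⟩
    exact le_antisymm ((card_triangles_le_of_iso f).trans (card_triangles_graphH_le (by omega))) h1
  · let e : Fin n ≃ HVertex 4 n :=
      (Fintype.equivFinOfCardEq (card_hVertex (by omega))).symm
    let f : (graphH 4 n).comap e ≃g graphH 4 n := SimpleGraph.Iso.comap e (graphH 4 n)
    have hsat := (graphH_saturated (n := n) (by omega)).of_iso f
    have hmin : ((graphH 4 n).comap e).minDegree = 4 := by
      rw [f.minDegree_eq, graphH_minDegree (by omega)]
    -- Besides the upper bound, this shows that the set is nonempty, so that its infimum is not the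
    -- default value 0.
    have hmem : ∃ G : SimpleGraph (Fin n), IsGraphSaturated (SimpleGraph.completeGraph (Fin 4)) G ∧
        G.minDegree = 4 ∧ G.copyCount (SimpleGraph.completeGraph (Fin 3)) =
          (triangles ((graphH 4 n).comap e)).card :=
      ⟨_, hsat, by convert hmin, copyCount_three_eq _⟩
    unfold satMinDeg
    apply le_antisymm
    · exact (Nat.sInf_le hmem).trans
        ((card_triangles_le_of_iso f).trans (card_triangles_graphH_le (by omega)))
    · refine le_csInf ⟨_, hmem⟩ ?_
      rintro m ⟨G, hG, hd, rfl⟩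
      rw [copyCount_three_eq]
      exact (triangle_bound G hn (Fintype.card_fin n) hG hd).1
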